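/- Let $k$ be an algebraically closed field and let $A$ be an associative unital $k$-algebra with Jacobson radical $R$. Assume that: 1. $A$ is *admissible*: $A/R$ and $R/R^2$ are finite dimensional over $k$, and the canonical map $A\to\varprojlim_{l\ge 0}A/R^l$ is bijective; 2. $A$ is *basic*: $A/R$ is isomorphic, as a $k$-algebra, to a finite direct product of copies of $k$; 3. $A$ is infinite dimensional over $k$; 4. $A$ is *mild*: for every nonzero two-sided ideal $I$ of $A$ that is closed in the $R$-adic topology, there are only finitely many isomorphism classes of indecomposable left $A/I$-modules of finite length. Then there is an integer $n\ge 1$ such that $A$ is isomorphic, as a $k$-algebra, to the complete path algebra $k[[Z_n]]$ of the cyclic quiver $Z_n$. Here $Z_n$ has vertices $1,\dots,n$ and exactly $n$ arrows, namely one arrow $i\to i+1$ for $1\le i<n$ and one arrow $n\to 1$. The algebra $k[[Z_n]]$ consists of all formal series $\sum_u a_u u$ with $a_u\in k$, where $u$ runs through the paths of $Z_n$ (including the path of length $0$ at each vertex), with multiplication $\left(\sum_u a_u u\right)\left(\sum_v b_v v\right)=\sum_w\left(\sum_{uv=w}a_u b_v\right)w$, where $uv$ denotes the path that runs first through $v$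 and then through $u$. -/

import Mathlib

universe u v w

/-! ### Admissible algebras -/

/-- An ideal `I` of `A` is closed for the `R`-adic topology, where `R` is the Jacobson radical of
`A`: every point `a` all of whose basic neighbourhoods `a + R ^ l` meet `I` lies in `I`. -/
def IsRadicallyClosed {A : Type v} [Ring A] (I : Ideal A) : Prop :=
  ∀ a : A, (∀ l : ℕ, ∃ b ∈ I, a - b ∈ Ring.jacobson A ^ l) → a ∈ I

/-- A `k`-algebra `A` with Jacobson radical `R` is admissible if `A / R` and `R / R ^ 2` are finite
dimensional and the canonical map from `A` to the inverse limit of the `A / R ^ l` is bijective. -/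
structure IsAdmissibleAlgebra (k : Type u) (A : Type v) [Field k] [Ring A] [Algebra k A] :
    Prop where
  finite_top : Module.Finite k (A ⧸ Ring.jacobson A)
  finite_cotangent :
    Module.Finite k (Ring.jacobson A ⧸ (Ring.jacobson A ^ 2).submoduleOf (Ring.jacobson A))
  /-- An element of the inverse limit is represented by a sequence `x` with
  `x (l + 1) ≡ x l` modulo `R ^ l`; it comes from exactly one element of `A`. -/
  complete : ∀ x : ℕ → A, (∀ l, x (l + 1) - x l ∈ Ring.jacobson A ^ l) →
    ∃! a : A, ∀ l, a - x l ∈ Ring.jacobson A ^ l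

/-- A `k`-algebra `A` with Jacobson radical `R` is basic if `A / R` is, as a `k`-algebra, a finite
direct product of copies of `k`. -/
def IsBasicAlgebra (k : Type u) (A : Type v) [Field k] [Ring A] [Algebra k A] : Prop :=
  ∃ n : ℕ, Nonempty ((A ⧸ Ring.jacobson A) ≃ₐ[k] (Fin n → k))

/-! ### Representation types -/

/-- A module is indecomposable if it is nonzero and is not the internal direct sum of two nonzero
submodules. -/
def IsIndecomposableModule (B : Type v) (M : Type w) [Ring B] [AddCommGroup M] [Module B M] :
    Prop :=
  Nontrivial M ∧ ∀ p q : Submodule B M, IsCompl p q → p = ⊥ ∨ q = ⊥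

/-- `B` is representation-finite: up to isomorphism there are only finitely many indecomposable
left `B`-modules of finite length. (A module of finite length is finitely generated, so
all of them occur, up to isomorphism, in the universe of `B`.) -/
def IsRepresentationFinite (B : Type v) [Ring B] : Prop :=
  ∃ S : Set (ModuleCat.{v} B), S.Finite ∧
    ∀ (M : Type v) [AddCommGroup M] [Module B M], IsFiniteLength B M →
      IsIndecomposableModule B M → ∃ N ∈ S, Nonempty (M ≃ₗ[B] N)

/-- `A` is mild: each quotient of `A` by a nonzero closed two-sided ideal is
representation-finite. -/
def IsMildAlgebra (A : Type v) [Ring A] : Prop :=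
  ∀ (I : Ideal A) [I.IsTwoSided], I ≠ ⊥ → IsRadicallyClosed I → IsRepresentationFinite (A ⧸ I)

/-! ### Complete path algebras -/

/-- The formal series `∑ a_w w`, where `w` runs through the paths of the quiver `V` and `a_w ∈ k`;
such a series is given by its family of coefficients. -/
def CompletePathAlgebra (k : Type u) (V : Type v) [Quiver.{w} V] : Type (max u v w) :=
  ∀ i j : V, Quiver.Path i j → k

namespace CompletePathAlgebra

section Factorizations

variable {V : Type v} [Quiver.{w} V]

/-- A list of all the ways to write a path from `i` to `j` as a path from `i` to some `m`
followed by a path from `m` to `j`; see `mem_factorizations` and `nodup_factorizations`. -/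
def factorizations {i : V} : ∀ {j : V}, Quiver.Path i j →
    List (Σ m : V, Quiver.Path i m × Quiver.Path m j)
  | _, .nil => [⟨i, .nil, .nil⟩]
  | j, .cons p e => ⟨j, p.cons e, .nil⟩ ::
      (factorizations p).map fun s => ⟨s.1, s.2.1, s.2.2.cons e⟩

theorem mem_factorizations {i j : V} (p : Quiver.Path i j)
    (s : Σ m : V, Quiver.Path i m × Quiver.Path m j) :
    s ∈ factorizations p ↔ s.2.1.comp s.2.2 = p := by
  induction p with
  | nil =>
    obtain ⟨m, v, u⟩ := s
    simp only [factorizations, List.mem_singleton]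
    constructor
    · intro h
      cases h
      rfl
    · intro h
      cases u with
      | nil =>
        have h : v = Quiver.Path.nil := h
        subst h
        rfl
      | cons u e => cases h
  | cons p e ih =>
    obtain ⟨m, v, u⟩ := s
    simp only [factorizations, List.mem_cons, List.mem_map]
    constructor
    · rintro (h | ⟨s, hs, h⟩)
      · cases h
        rfl
      · cases h
        have := (ih s).1 hs
        simp [this]
    · intro h
      cases u with
      | nil =>
        left
        have h : v = p.cons e := h
        subst h
        rfl
      | cons u f =>
        right
        rw [Quiver.Path.comp_cons] at h
        cases h
        exact ⟨⟨m, v, u⟩, (ih _).2 rfl, rfl⟩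

theorem nodup_factorizations {i j : V} (p : Quiver.Path i j) : (factorizations p).Nodup := by
  induction p with
  | nil => simp [factorizations]
  | cons p e ih =>
    rw [factorizations, List.nodup_cons]
    constructor
    · simp only [List.mem_map, not_exists, not_and]
      rintro ⟨m, v, u⟩ _ h
      have h1 := congrArg (fun s => s.2.2.length) h
      simp at h1
    · refine ih.map ?_
      rintro ⟨m, v, u⟩ ⟨m', v', u'⟩ h
      simp only [Sigma.mk.injEq] at h
      obtain ⟨rfl, h⟩ := h
      simp only [heq_eq_eq, Prod.mk.injEq, Quiver.Path.cons.injEq, true_and, and_true] at h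
      obtain ⟨rfl, rfl⟩ := h
      rfl

end Factorizations

section Algebra

variable {k : Type u} {V : Type v} [Quiver.{w} V]

@[ext]
theorem ext {a b : CompletePathAlgebra k V}
    (h : ∀ (i j : V) (p : Quiver.Path i j), a i j p = b i j p) : a = b :=
  funext fun i => funext fun j => funext fun p => h i j p

variable [Field k]

instance : AddCommGroup (CompletePathAlgebra k V) :=
  inferInstanceAs (AddCommGroup (∀ i j : V, Quiver.Path i j → k))

instance : Module k (CompletePathAlgebra k V) :=
  inferInstanceAs (Module k (∀ i j : V, Quiver.Path i j → k))

/-- The unit element is the sum of the paths of length `0`. -/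
instance : One (CompletePathAlgebra k V) where
  one _ _ p := if p.length = 0 then 1 else 0

/-- The coefficient of `a * b` at a path `p` is the sum of the `a_u * b_v` over all
factorizations `p = u v`. Paths are composed like maps: in `u v` one first runs through `v`. -/
instance : Mul (CompletePathAlgebra k V) where
  mul a b i j p := ((factorizations p).map fun s => a s.1 j s.2.2 * b i s.1 s.2.1).sum

/-- The multiplication with a left factor of which only the coefficients at the paths with a fixed
target are kept. -/
def conv {j : V} (f : ∀ m : V, Quiver.Path m j → k) (b : CompletePathAlgebra k V) (i : V)
    (p : Quiver.Path i j) : k :=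
  ((factorizations p).map fun s => f s.1 s.2.2 * b i s.1 s.2.1).sum

@[simp]
theorem add_apply (a b : CompletePathAlgebra k V) (i j : V) (p : Quiver.Path i j) :
    (a + b) i j p = a i j p + b i j p := rfl

@[simp]
theorem zero_apply (i j : V) (p : Quiver.Path i j) :
    (0 : CompletePathAlgebra k V) i j p = 0 := rfl

@[simp]
theorem smul_apply (c : k) (a : CompletePathAlgebra k V) (i j : V) (p : Quiver.Path i j) :
    (c • a) i j p = c * a i j p := rfl

theorem one_apply (i j : V) (p : Quiver.Path i j) :
    (1 : CompletePathAlgebra k V) i j p = if p.length = 0 then 1 else 0 := rfl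

theorem mul_apply (a b : CompletePathAlgebra k V) (i j : V) (p : Quiver.Path i j) :
    (a * b) i j p = ((factorizations p).map fun s => a s.1 j s.2.2 * b i s.1 s.2.1).sum := rfl

theorem mul_apply_eq_conv (a b : CompletePathAlgebra k V) (i j : V) (p : Quiver.Path i j) :
    (a * b) i j p = conv (fun m => a m j) b i p := rfl

theorem conv_nil {i : V} (f : ∀ m : V, Quiver.Path m i → k) (b : CompletePathAlgebra k V) :
    conv f b i .nil = f i .nil * b i i .nil := by
  simp [conv, factorizations]

theorem conv_cons {i l j : V} (f : ∀ m : V, Quiver.Path m j → k) (b : CompletePathAlgebra k V)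
    (p : Quiver.Path i l) (e : l ⟶ j) :
    conv f b i (p.cons e) =
      f j .nil * b i j (p.cons e) + conv (fun m u => f m (u.cons e)) b i p := by
  simp [conv, factorizations, List.map_map, Function.comp_def]

theorem conv_add_left {i j : V} (f g : ∀ m : V, Quiver.Path m j → k)
    (b : CompletePathAlgebra k V) (p : Quiver.Path i j) :
    conv (fun m u => f m u + g m u) b i p = conv f b i p + conv g b i p := by
  simp [conv, add_mul, List.sum_map_add]

theorem conv_smul_left {i j : V} (c : k) (f : ∀ m : V, Quiver.Path m j → k)
    (b : CompletePathAlgebra k V) (p : Quiver.Path i j) :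
    conv (fun m u => c * f m u) b i p = c * conv f b i p := by
  simp [conv, mul_assoc, List.sum_map_mul_left]

theorem conv_zero_left {i j : V} (b : CompletePathAlgebra k V) (p : Quiver.Path i j) :
    conv (fun _ _ => (0 : k)) b i p = 0 := by
  simp [conv]

theorem conv_conv {i j : V} (f : ∀ m : V, Quiver.Path m j → k) (b c : CompletePathAlgebra k V)
    (p : Quiver.Path i j) : conv (conv f b) c i p = conv f (b * c) i p := by
  induction p with
  | nil => simp [conv_nil, mul_apply_eq_conv, mul_assoc]
  | cons p e ih =>
    simp only [conv_cons, conv_nil, conv_add_left, conv_smul_left, ih, mul_apply_eq_conv]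
    ring

theorem conv_one_right {i j : V} (f : ∀ m : V, Quiver.Path m j → k) (p : Quiver.Path i j) :
    conv f 1 i p = f i p := by
  induction p with
  | nil => simp [conv_nil, one_apply]
  | cons p e ih => simp [conv_cons, one_apply, ih]

theorem conv_one_left {i j : V} (b : CompletePathAlgebra k V) (p : Quiver.Path i j) :
    conv (fun m => (1 : CompletePathAlgebra k V) m j) b i p = b i j p := by
  cases p with
  | nil => simp [conv_nil, one_apply]
  | cons p e => simp [conv_cons, one_apply, conv_zero_left]

instance : Ring (CompletePathAlgebra k V) where
  __ := (inferInstance : AddCommGroup (CompletePathAlgebra k V))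
  mul_assoc a b c := by
    ext i j p
    exact conv_conv (fun m => a m j) b c p
  one_mul a := by
    ext i j p
    exact conv_one_left a p
  mul_one a := by
    ext i j p
    exact conv_one_right (fun m => a m j) p
  left_distrib a b c := by
    ext i j p
    simp [mul_apply, mul_add, List.sum_map_add]
  right_distrib a b c := by
    ext i j p
    simp [mul_apply, add_mul, List.sum_map_add]
  zero_mul a := by
    ext i j p
    simp [mul_apply]
  mul_zero a := by
    ext i j p
    simp [mul_apply]

instance : Algebra k (CompletePathAlgebra k V) :=
  Algebra.ofModule
    (fun c a b => by
      ext i j p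
      simp [mul_apply, mul_assoc, List.sum_map_mul_left])
    (fun c a b => by
      ext i j p
      simp [mul_apply, mul_left_comm, List.sum_map_mul_left])

end Algebra

end CompletePathAlgebra

/-! ### Cyclic quivers -/

/-- The cyclic quiver `Z_n`, `n ≥ 1`: its vertices are the integers modulo `n`, and there is
exactly one arrow from each vertex `i` to `i + 1` and no other arrow. -/
def CyclicQuiver (n : ℕ) : Type := ZMod n

instance (n : ℕ) : Quiver.{0} (CyclicQuiver n) where
  Hom := fun i j : ZMod n => PLift (j = i + 1)

/-! ### The radical filtration of an admissible algebra -/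

/-! Let R be the radical and e_i a system of idempotents lifting the unit vectors of A/R; think of
e_i A e_j as the combinations of paths from j to i. As A is infinite dimensional, no R^l vanishes,
so every A/R^l is representation-finite. The proof confronts mildness with infinite families of
indecomposables (`IsMildAlgebra.false_of_family`).

Primeness: the closure of a nonzero two-sided ideal contains a power of R, since otherwise
truncations of some A e_i have infinitely many Loewy lengths. If aAb = 0 with a, b nonzero, two such
powers have product zero, which is absurd (`exists_mul_mul_ne_zero`).

One vertex: two independent elements in the radical of e_i A e_i modulo its square would give a
family of cyclic modules parametrized by k. So this corner is topologically generated by one element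
x and hence commutative; being prime, it is a discrete valuation ring (`exists_isUniformizer`). Each
e_i A e_j embeds into such a ring, and its radical part has a generator g_ij that works from both
sides (`exists_isRadicalGenerator`).

Two vertices p ≠ q: if the cycle g_pq g_qp did not generate the radical of e_p A e_p, then g_pp,
g_pq, g_qp, g_qq would be four arrows modulo radical square. Their separated quiver is a four-cycle,
which again carries a family parametrized by k. Hence g_pp is a multiple of g_pq g_qp
(`exists_radical_eq_mul`), and cancellation leaves at most one g_ij outside R^2 for each j
(`eq_of_notMem_jacobson_sq`).

So exactly one arrow j → σ j starts at each vertex. By primeness every e_i A e_j is nonzero, so σ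
has a single orbit and is a cycle. Completeness expands each element as a series in the paths,
uniquely because R^l e_i is never zero. -/

section Radical

variable {A : Type v} [Ring A]

local notation "𝔯" => Ring.jacobson A

@[simp]
theorem mem_jacobson_pow_zero (a : A) : a ∈ 𝔯 ^ 0 := by
  rw [Submodule.pow_zero, Ideal.one_eq_top]
  trivial

@[simp]
theorem mem_jacobson_pow_one {a : A} : a ∈ 𝔯 ^ 1 ↔ a ∈ 𝔯 := by
  rw [Submodule.pow_one]

theorem mul_mem_jacobson_pow_add {l m : ℕ} {a b : A} (ha : a ∈ 𝔯 ^ l) (hb : b ∈ 𝔯 ^ m) :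
    a * b ∈ 𝔯 ^ (l + m) := by
  induction m generalizing b with
  | zero => exact Ideal.mul_mem_right _ _ ha
  | succ m ih =>
    rw [Submodule.pow_succ] at hb
    rw [← add_assoc, Submodule.pow_succ]
    refine Submodule.smul_induction_on hb (fun r hr s hs => ?_) (fun x y hx hy => ?_)
    · rw [smul_eq_mul, ← mul_assoc]
      exact Ideal.mul_mem_mul (ih hr) hs
    · rw [mul_add]
      exact add_mem hx hy

theorem mul_mem_jacobson_pow_left {l : ℕ} (a : A) {b : A} (hb : b ∈ 𝔯 ^ l) : a * b ∈ 𝔯 ^ l :=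
  Ideal.mul_mem_left _ _ hb

theorem mul_mem_jacobson_pow_right {l : ℕ} {a : A} (b : A) (ha : a ∈ 𝔯 ^ l) : a * b ∈ 𝔯 ^ l :=
  Ideal.mul_mem_right _ _ ha

theorem pow_mem_jacobson_pow {a : A} (ha : a ∈ 𝔯) (l : ℕ) : a ^ l ∈ 𝔯 ^ l := by
  induction l with
  | zero => simp
  | succ l ih =>
    rw [pow_succ]
    exact mul_mem_jacobson_pow_add ih (by simpa using ha)

theorem mul_mem_jacobson_sq {a b : A} (ha : a ∈ 𝔯) (hb : b ∈ 𝔯) : a * b ∈ 𝔯 ^ 2 :=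
  mul_mem_jacobson_pow_add (l := 1) (m := 1) (by simpa using ha) (by simpa using hb)

theorem mem_jacobson_of_mem_pow {l : ℕ} (hl : l ≠ 0) {a : A} (ha : a ∈ 𝔯 ^ l) : a ∈ 𝔯 := by
  have := Ideal.pow_le_pow_right (I := 𝔯) (Nat.one_le_iff_ne_zero.2 hl) ha
  simpa using this

theorem exists_inverse_one_add {a : A} (ha : a ∈ 𝔯) : ∃ b, (1 + a) * b = 1 ∧ b * (1 + a) = 1 := by
  have key : ∀ a ∈ 𝔯, ∃ b, b * (1 + a) = 1 := by
    intro a ha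
    rw [← Ideal.jacobson_bot, Ideal.mem_jacobson_iff] at ha
    obtain ⟨z, hz⟩ := ha 1
    refine ⟨z, ?_⟩
    rw [Ideal.mem_bot, sub_eq_zero] at hz
    rw [mul_add, mul_one, ← hz, mul_one, add_comm]
  obtain ⟨b, hb⟩ := key a ha
  -- The left inverse is again 1 plus a radical element, so it has a left inverse itself, which must
  -- be 1 + a.
  have hb' : b = 1 + -(b * a) := by
    rw [← hb]
    noncomm_ring
  obtain ⟨c, hc⟩ := key _ (neg_mem (Ideal.mul_mem_left 𝔯 b ha))
  rw [← hb'] at hc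
  refine ⟨b, ?_, hb⟩
  have : c = 1 + a := by
    calc c = c * (b * (1 + a)) := by rw [hb, mul_one]
      _ = 1 + a := by rw [← mul_assoc, hc, one_mul]
  rw [← this, hc]

theorem isRadicallyClosed_of_jacobson_pow_le {I : Ideal A} {l : ℕ} (h : 𝔯 ^ l ≤ I) :
    IsRadicallyClosed I := by
  intro a ha
  obtain ⟨b, hb, hab⟩ := ha l
  simpa using add_mem (h hab) hb

end Radical

namespace IsAdmissibleAlgebra

variable {k : Type u} {A : Type v} [Field k] [Ring A] [Algebra k A]

local notation "𝔯" => Ring.jacobson A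

theorem eq_zero (h : IsAdmissibleAlgebra k A) {a : A} (ha : ∀ l, a ∈ 𝔯 ^ l) : a = 0 := by
  obtain ⟨b, -, hb⟩ := h.complete (fun _ => 0) (fun l => by simp)
  rw [hb a (fun l => by simpa using ha l), hb 0 (fun l => by simp)]

theorem eq_of_sub_mem (h : IsAdmissibleAlgebra k A) {a b : A} (hab : ∀ l, a - b ∈ 𝔯 ^ l) :
    a = b :=
  sub_eq_zero.1 (h.eq_zero hab)

/-- Products of representatives of R/R^2 span each layer R^l / R^(l+1), so all A/R^l are finite
dimensional. Phrased with a subspace of A, this serves quotients of A and of A × A alike. -/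
theorem exists_finite_supplement (h : IsAdmissibleAlgebra k A) (l : ℕ) :
    ∃ F : Submodule k A, Module.Finite k F ∧ ∀ a, ∃ f ∈ F, a - f ∈ 𝔯 ^ l := by
  have hV : ∃ V : Submodule k A, Module.Finite k V ∧ ∀ a ∈ 𝔯, ∃ f ∈ V, a - f ∈ 𝔯 ^ 2 := by
    have := h.finite_cotangent
    obtain ⟨s, hs⟩ := this
    choose g hg using (Submodule.mkQ_surjective ((𝔯 ^ 2).submoduleOf 𝔯))
    refine ⟨Submodule.span k ((fun x => (g x : A)) '' s),
      FiniteDimensional.span_of_finite k (s.finite_toSet.image _), fun a ha => ?_⟩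
    have hq : ∀ q : 𝔯 ⧸ (𝔯 ^ 2).submoduleOf 𝔯, ∃ f ∈ Submodule.span k ((fun x => (g x : A)) '' s),
        ((g q : 𝔯) : A) - f ∈ 𝔯 ^ 2 := by
      have hmem : ∀ x y : 𝔯, Submodule.mkQ ((𝔯 ^ 2).submoduleOf 𝔯) x =
          Submodule.mkQ ((𝔯 ^ 2).submoduleOf 𝔯) y → (x : A) - y ∈ 𝔯 ^ 2 := by
        intro x y hxy
        have := (Submodule.Quotient.eq _).1 hxy
        exact this
      intro q
      have hq : q ∈ Submodule.span k (s : Set (𝔯 ⧸ (𝔯 ^ 2).submoduleOf 𝔯)) := by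
        rw [hs]; trivial
      induction hq using Submodule.span_induction with
      | mem x hx => exact ⟨g x, Submodule.subset_span ⟨x, hx, rfl⟩, by simp⟩
      | zero => exact ⟨0, zero_mem _, by simpa using hmem (g 0) 0 (by rw [hg]; simp)⟩
      | add x y _ _ hx hy =>
        obtain ⟨f, hf, hf'⟩ := hx
        obtain ⟨f₂, hf₂, hf₂'⟩ := hy
        refine ⟨f + f₂, add_mem hf hf₂, ?_⟩
        have := hmem (g (x + y)) (g x + g y) (by rw [map_add, hg, hg, hg])
        have := add_mem this (add_mem hf' hf₂')
        convert this using 1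
        push_cast
        abel
      | smul c x _ hx =>
        obtain ⟨f, hf, hf'⟩ := hx
        refine ⟨c • f, Submodule.smul_mem _ _ hf, ?_⟩
        have h1 := hmem (g (c • x)) (c • g x) (by
          rw [hg]
          change c • x = c • Submodule.mkQ _ (g x)
          rw [hg])
        have h2 : c • (((g x : 𝔯) : A) - f) ∈ 𝔯 ^ 2 := by
          rw [Algebra.smul_def]
          exact Ideal.mul_mem_left _ _ hf'
        have := add_mem h1 h2
        convert this using 1
        rw [smul_sub]
        simp
    obtain ⟨f, hf, hf'⟩ := hq (Submodule.mkQ _ ⟨a, ha⟩)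
    refine ⟨f, hf, ?_⟩
    have h1 := (Submodule.Quotient.eq _).1 (hg (Submodule.mkQ ((𝔯 ^ 2).submoduleOf 𝔯) ⟨a, ha⟩))
    change _ - a ∈ 𝔯 ^ 2 at h1
    have := sub_mem hf' h1
    convert this using 1
    abel
  have hT : ∃ V : Submodule k A, Module.Finite k V ∧ ∀ a, ∃ f ∈ V, a - f ∈ 𝔯 := by
    obtain ⟨s, hs⟩ := h.finite_top
    choose g hg using (Ideal.Quotient.mkₐ_surjective k 𝔯)
    refine ⟨Submodule.span k (g '' s),
      FiniteDimensional.span_of_finite k (s.finite_toSet.image _), fun a => ?_⟩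
    have : Ideal.Quotient.mkₐ k 𝔯 a ∈
        (Submodule.span k (g '' s)).map (Ideal.Quotient.mkₐ k 𝔯).toLinearMap := by
      rw [Submodule.map_span, ← Set.image_comp]
      have : (⇑(Ideal.Quotient.mkₐ k 𝔯).toLinearMap ∘ g) = id := funext hg
      rw [this, Set.image_id, hs]
      trivial
    obtain ⟨f, hf, hf'⟩ := this
    exact ⟨f, hf, Ideal.Quotient.eq.1 hf'.symm⟩
  obtain ⟨V, hVf, hV⟩ := hV
  obtain ⟨T, hTf, hT⟩ := hT
  -- The representatives are kept inside R^l: in rs − fg = (r − f)s + f(s − g) the second summand is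
  -- small enough only if f lies in R^l.
  have hW : ∀ l, ∃ W : Submodule k A, Module.Finite k W ∧ ∀ a ∈ 𝔯 ^ l,
      ∃ f ∈ W, f ∈ 𝔯 ^ l ∧ a - f ∈ 𝔯 ^ (l + 1) := by
    intro l
    induction l with
    | zero =>
      refine ⟨T, hTf, fun a _ => ?_⟩
      obtain ⟨f, hf, hf'⟩ := hT a
      exact ⟨f, hf, by simp, by rwa [zero_add, mem_jacobson_pow_one]⟩
    | succ l ih =>
      obtain ⟨W, hWf, hW⟩ := ih
      refine ⟨W * V, ?_, fun a ha => ?_⟩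
      · rw [Module.Finite.iff_fg] at *
        exact hWf.mul hVf
      · rw [Submodule.pow_succ] at ha
        refine Submodule.smul_induction_on ha (fun r hr s hs => ?_) (fun x y hx hy => ?_)
        · obtain ⟨f, hf, hfl, hf'⟩ := hW r hr
          obtain ⟨g, hg, hg'⟩ := hV s hs
          have hgr : g ∈ 𝔯 := by
            have := sub_mem hs (mem_jacobson_of_mem_pow two_ne_zero hg')
            simpa using this
          refine ⟨f * g, Submodule.mul_mem_mul hf hg,
            mul_mem_jacobson_pow_add hfl (m := 1) (by simpa using hgr), ?_⟩
          have h1 : (r - f) * s ∈ 𝔯 ^ (l + 1 + 1) :=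
            mul_mem_jacobson_pow_add hf' (by simpa using hs)
          have h2 : f * (s - g) ∈ 𝔯 ^ (l + 2) := mul_mem_jacobson_pow_add hfl hg'
          convert add_mem h1 h2 using 1
          simp only [smul_eq_mul]
          noncomm_ring
        · obtain ⟨f, hf, hfl, hf'⟩ := hx
          obtain ⟨g, hg, hgl, hg'⟩ := hy
          refine ⟨f + g, add_mem hf hg, add_mem hfl hgl, ?_⟩
          convert add_mem hf' hg' using 1
          abel
  induction l with
  | zero => exact ⟨⊥, inferInstance, fun a => ⟨0, zero_mem _, by simp⟩⟩
  | succ l ih =>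
    obtain ⟨F, hF, hF'⟩ := ih
    obtain ⟨W, hWf, hW⟩ := hW l
    refine ⟨F ⊔ W, inferInstance, fun a => ?_⟩
    obtain ⟨f, hf, hf'⟩ := hF' a
    obtain ⟨g, hg, -, hg'⟩ := hW _ hf'
    exact ⟨f + g, add_mem (Submodule.mem_sup_left hf) (Submodule.mem_sup_right hg), by
      simpa [sub_sub] using hg'⟩

theorem finite_quotient (h : IsAdmissibleAlgebra k A) {W : Ideal A} {l : ℕ} (hW : 𝔯 ^ l ≤ W) :
    Module.Finite k (A ⧸ W) := by
  obtain ⟨F, hF, hF'⟩ := h.exists_finite_supplement l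
  refine Module.Finite.of_surjective (((Submodule.mkQ W).restrictScalars k).comp F.subtype) ?_
  intro q
  obtain ⟨a, rfl⟩ := Submodule.mkQ_surjective W q
  obtain ⟨f, hf, hf'⟩ := hF' a
  refine ⟨⟨f, hf⟩, ?_⟩
  exact ((Submodule.Quotient.eq W).2 (hW hf')).symm

/-- This makes every power of the radical a legitimate ideal for the mildness condition. -/
theorem jacobson_pow_ne_bot (h : IsAdmissibleAlgebra k A) (hinf : ¬ Module.Finite k A) (l : ℕ) :
    𝔯 ^ l ≠ ⊥ := by
  intro hl
  apply hinf
  obtain ⟨F, hF, hF'⟩ := h.exists_finite_supplement l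
  refine Module.Finite.of_surjective F.subtype fun a => ?_
  obtain ⟨f, hf, hf'⟩ := hF' a
  rw [hl, Ideal.mem_bot, sub_eq_zero] at hf'
  exact ⟨⟨f, hf⟩, hf'.symm⟩

/-- A series whose `m`-th term lies in `R ^ m` converges. -/
theorem exists_sum (h : IsAdmissibleAlgebra k A) (f : ℕ → A) (hf : ∀ m, f m ∈ 𝔯 ^ m) :
    ∃ a, ∀ l, a - ∑ m ∈ Finset.range l, f m ∈ 𝔯 ^ l :=
  (h.complete (fun l => ∑ m ∈ Finset.range l, f m) (fun l => by
    simpa [Finset.sum_range_succ] using hf l)).exists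

end IsAdmissibleAlgebra

/-! ### Primitive idempotents of a basic algebra -/

section PrimitiveSystem

variable {k : Type u} {A : Type v} [Field k] [Ring A] [Algebra k A]

local notation "𝔯" => Ring.jacobson A

variable (k) in
/-- A complete orthogonal system of idempotents `e` that maps to the system of unit vectors under
an isomorphism of the quotient by the radical with a product of copies of `k`. -/
structure IsPrimitiveSystem {ι : Type w} [Fintype ι] (e : ι → A) : Prop where
  complete : CompleteOrthogonalIdempotents e
  diagonal : ∀ i a, ∃ c : k, e i * a * e i - c • e i ∈ 𝔯
  off_diagonal : ∀ {i j}, i ≠ j → ∀ a, e i * a * e j ∈ 𝔯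
  notMem : ∀ i, e i ∉ 𝔯

/-- The unit vectors are lifted step by step along A/R^(l+2) → A/R^(l+1), whose kernel has square
zero; the compatible lifts converge in A, and the idempotent relations pass to the limit because
they hold modulo every power. -/
theorem exists_isPrimitiveSystem (h : IsAdmissibleAlgebra k A) (hb : IsBasicAlgebra k A) :
    ∃ (n : ℕ) (e : Fin n → A), IsPrimitiveSystem k e := by
  obtain ⟨n, ⟨φ⟩⟩ := hb
  set π : A →ₐ[k] (Fin n → k) := φ.toAlgHom.comp (Ideal.Quotient.mkₐ k 𝔯) with hπ
  have hπ0 : ∀ a, π a = 0 ↔ a ∈ 𝔯 := fun a => by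
    rw [← Ideal.Quotient.eq_zero_iff_mem (I := 𝔯)]
    exact map_eq_zero_iff φ φ.injective
  have hπs : Function.Surjective π := φ.surjective.comp (Ideal.Quotient.mkₐ_surjective k 𝔯)
  let f : ∀ l, A ⧸ 𝔯 ^ (l + 1 + 1) →+* A ⧸ 𝔯 ^ (l + 1) := fun l =>
    Ideal.Quotient.factor (Ideal.pow_le_pow_right (Nat.le_succ (l + 1)))
  let T : ℕ → Type v := fun l => {x : Fin n → A ⧸ 𝔯 ^ (l + 1) // CompleteOrthogonalIdempotents x}
  have hstep : ∀ l (x : T l), ∃ y : T (l + 1), f l ∘ y.1 = x.1 := by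
    intro l x
    obtain ⟨y, hy, hxy⟩ := CompleteOrthogonalIdempotents.lift_of_isNilpotent_ker (f l) (by
      intro b hb
      obtain ⟨a, rfl⟩ := Ideal.Quotient.mk_surjective b
      have ha : a ∈ 𝔯 ^ (l + 1) := Ideal.Quotient.eq_zero_iff_mem.1 hb
      refine ⟨2, ?_⟩
      rw [← map_pow, Ideal.Quotient.eq_zero_iff_mem, pow_two]
      exact Ideal.pow_le_pow_right (by omega) (mul_mem_jacobson_pow_add ha ha)) x.2 (fun i => by
        obtain ⟨a, ha⟩ := Ideal.Quotient.mk_surjective (x.1 i)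
        exact ⟨Ideal.Quotient.mk _ a, ha⟩)
    exact ⟨⟨y, hy⟩, hxy⟩
  choose step hstep using hstep
  let ρ : A ⧸ 𝔯 ^ (0 + 1) →+* (Fin n → k) := Ideal.Quotient.lift _ π.toRingHom (by
    intro a ha
    exact (hπ0 a).2 (by simpa using ha))
  have hsingle : CompleteOrthogonalIdempotents (fun i : Fin n => (Pi.single i 1 : Fin n → k)) :=
    CompleteOrthogonalIdempotents.single _
  obtain ⟨x₀, hx₀, hx₀'⟩ := CompleteOrthogonalIdempotents.lift_of_isNilpotent_ker ρ (by
      intro b hb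
      obtain ⟨a, rfl⟩ := Ideal.Quotient.mk_surjective b
      have ha : π a = 0 := hb
      refine ⟨1, ?_⟩
      rw [pow_one, Ideal.Quotient.eq_zero_iff_mem]
      simpa using (hπ0 a).1 ha) hsingle (fun i => by
        obtain ⟨a, ha⟩ := hπs (Pi.single i 1)
        exact ⟨Ideal.Quotient.mk _ a, ha⟩)
  let x : ∀ l, T l := fun l => Nat.rec ⟨x₀, hx₀⟩ step l
  have hx : ∀ l, f l ∘ (x (l + 1)).1 = (x l).1 := fun l => hstep l (x l)
  choose y hy using fun l i => Ideal.Quotient.mk_surjective ((x l).1 i)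
  have hyy : ∀ l i, y (l + 1) i - y l i ∈ 𝔯 ^ (l + 1) := by
    intro l i
    rw [← Ideal.Quotient.eq, hy, ← hx]
    exact congrArg (f l) (hy (l + 1) i)
  have hlim : ∀ i, ∃ a, ∀ l, a - y l i ∈ 𝔯 ^ l := fun i =>
    (h.complete (fun l => y l i) (fun l =>
      Ideal.pow_le_pow_right (Nat.le_succ l) (hyy l i))).exists
  choose e he using hlim
  have hmk : ∀ l i, Ideal.Quotient.mk (𝔯 ^ (l + 1)) (e i) = (x l).1 i := by
    intro l i
    rw [← hy, Ideal.Quotient.eq]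
    simpa using add_mem (he i (l + 1)) (hyy l i)
  have heq : ∀ a b : A, (∀ l, Ideal.Quotient.mk (𝔯 ^ (l + 1)) a = Ideal.Quotient.mk _ b) →
      a = b := fun a b hab => h.eq_of_sub_mem fun l =>
        Ideal.pow_le_pow_right (Nat.le_succ l) (Ideal.Quotient.eq.1 (hab l))
  have hcomp : CompleteOrthogonalIdempotents e := by
    refine ⟨⟨fun i => ?_, fun i j hij => ?_⟩, ?_⟩
    · refine heq _ _ fun l => ?_
      rw [map_mul, hmk]
      exact (x l).2.idem i
    · refine heq _ _ fun l => ?_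
      rw [map_mul, hmk, hmk, map_zero]
      exact (x l).2.ortho hij
    · refine heq _ _ fun l => ?_
      rw [map_sum, map_one]
      simp only [hmk]
      exact (x l).2.complete
  have hπe : ∀ i, π (e i) = Pi.single i 1 := by
    intro i
    have := congrFun hx₀' i
    rw [← this, Function.comp_apply]
    change _ = ρ ((x 0).1 i)
    rw [← hmk]
    rfl
  refine ⟨n, e, hcomp, fun i a => ⟨π a i, ?_⟩, fun {i j} hij a => ?_, fun i => ?_⟩
  · rw [← hπ0]
    simp only [map_sub, map_mul, map_smul, hπe]
    ext j
    rcases eq_or_ne i j with rfl | hij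
    · simp
    · simp [hij.symm]
  · rw [← hπ0]
    simp only [map_mul, hπe]
    ext l
    rcases eq_or_ne i l with rfl | hil
    · simp [hij]
    · simp [Pi.single_apply, hil.symm]
  · rw [← hπ0, hπe]
    intro h0
    simpa using congrFun h0 i

end PrimitiveSystem

/-! ### Infinite families of indecomposable modules -/

section Families

variable {A : Type v} [Ring A]

/-- Each module has the same submodules over A as over A/I, so length and indecomposability descend;
the pigeonhole principle does the rest. Working over A spares all later families the passage to the
quotient ring. -/
theorem IsMildAlgebra.false_of_family (hm : IsMildAlgebra A) {I : Ideal A} [I.IsTwoSided]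
    (hI : I ≠ ⊥) (hc : IsRadicallyClosed I) {ι : Type w} [Infinite ι] (M : ι → Type v)
    [∀ i, AddCommGroup (M i)] [∀ i, Module A (M i)]
    (ann : ∀ i, Module.IsTorsionBySet A (M i) (I : Set A))
    (fl : ∀ i, IsFiniteLength A (M i)) (ind : ∀ i, IsIndecomposableModule A (M i))
    (noniso : ∀ i j, Nonempty (M i ≃ₗ[A] M j) → i = j) : False := by
  obtain ⟨S, hS, hS'⟩ := hm I hI hc
  let mod : ∀ i, Module (A ⧸ I) (M i) := fun i => (ann i).module
  have tower : ∀ i, IsScalarTower A (A ⧸ I) (M i) := fun i => (ann i).isScalarTower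
  have key : ∀ i, ∃ N ∈ S, Nonempty (M i ≃ₗ[A ⧸ I] N) := by
    intro i
    refine hS' (M i) ?_ ⟨(ind i).1, fun p q hpq => ?_⟩
    · obtain ⟨h1, h2⟩ := isFiniteLength_iff_isNoetherian_isArtinian.1 (fl i)
      exact isFiniteLength_iff_isNoetherian_isArtinian.2
        ⟨isNoetherian_of_tower A h1, isArtinian_of_tower A h2⟩
    · have : IsCompl (p.restrictScalars A) (q.restrictScalars A) := by
        rw [isCompl_iff, Submodule.disjoint_def, Submodule.codisjoint_iff_exists_add_eq] at hpq ⊢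
        exact hpq
      simpa using (ind i).2 _ _ this
  choose N hN hN' using key
  have := hS.to_subtype
  obtain ⟨i, j, hij, h⟩ := Finite.exists_ne_map_eq_of_infinite (fun i => (⟨N i, hN i⟩ : S))
  have h : N i = N j := congrArg Subtype.val h
  obtain ⟨f⟩ := hN' i
  obtain ⟨g⟩ := hN' j
  rw [← h] at g
  exact hij (noniso i j ⟨(f.trans g.symm).restrictScalars A⟩)

variable {k : Type u} [Field k] [Algebra k A]

/-- The projection f onto a summand is idempotent. With f − c nilpotent, the identities f(f − c)^n =
(1 − c)^n f and (1 − f)(f − 1)^n = ±(1 − f) force f = 0 if c ≠ 1 and f = 1 if c = 1. -/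
theorem isIndecomposableModule_of_end {M : Type w} [AddCommGroup M] [Module A M] [Module k M]
    [IsScalarTower k A M] [Nontrivial M]
    (h : ∀ f : Module.End A M, ∃ (c : k) (n : ℕ), (f - c • 1) ^ n = 0) :
    IsIndecomposableModule A M := by
  refine ⟨inferInstance, fun p q hpq => ?_⟩
  set f : Module.End A M := p.projection q hpq with hf
  have hff : f * f = f := by
    ext x
    exact Submodule.projection_apply_of_mem_left hpq (Submodule.projection_apply_mem hpq x)
  obtain ⟨c, n, hn⟩ := h f
  rcases eq_or_ne c 1 with rfl | hc
  · right
    have h1 : ∀ n, (1 - f) * (f - (1 : k) • 1) ^ n = (-1) ^ n * (1 - f) := by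
      intro n
      induction n with
      | zero => simp
      | succ n ih =>
        rw [pow_succ, ← mul_assoc, ih, pow_succ, mul_assoc, mul_assoc]
        congr 1
        rw [one_smul, mul_sub, sub_mul, hff]
        simp
    have h2 : (-1 : Module.End A M) ^ n * (1 - f) = 0 := by rw [← h1, hn, mul_zero]
    have h3 : f = 1 := by
      rcases neg_one_pow_eq_or (Module.End A M) n with h | h <;> rw [h] at h2
      · rw [one_mul, sub_eq_zero] at h2
        exact h2.symm
      · rw [neg_mul, one_mul, neg_eq_zero, sub_eq_zero] at h2
        exact h2.symm
    rw [eq_bot_iff]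
    intro x hx
    have : f x = 0 := by
      rw [hf, Submodule.projection_apply]
      simpa using (Submodule.projectionOnto_apply_eq_zero_iff hpq).2 hx
    rw [h3] at this
    exact this
  · left
    have h1 : ∀ n, f * (f - c • 1) ^ n = (1 - c) ^ n • f := by
      intro n
      induction n with
      | zero => simp
      | succ n ih =>
        rw [pow_succ, ← mul_assoc, ih, pow_succ, smul_mul_assoc, mul_smul]
        congr 1
        rw [mul_sub, hff, mul_smul_comm, mul_one, sub_smul, one_smul]
    have h2 : f = 0 := by
      have := h1 n
      rw [hn, mul_zero] at this
      exact (smul_eq_zero.1 this.symm).resolve_left (pow_ne_zero _ (sub_ne_zero.2 hc.symm))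
    rw [eq_bot_iff]
    intro x hx
    have : f x = x := Submodule.projection_apply_of_mem_left hpq hx
    rw [h2] at this
    exact this.symm

theorem isFiniteLength_of_finite (k : Type u) [Field k] [Algebra k A] {M : Type w} [AddCommGroup M]
    [Module A M] [Module k M] [IsScalarTower k A M] [Module.Finite k M] : IsFiniteLength A M :=
  isFiniteLength_iff_isNoetherian_isArtinian.2
    ⟨isNoetherian_of_tower k inferInstance, isArtinian_of_tower k inferInstance⟩

local notation "𝔯" => Ring.jacobson A

theorem isTorsionBySet_quotient {I W : Ideal A} [I.IsTwoSided] (h : I ≤ W) :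
    Module.IsTorsionBySet A (A ⧸ W) (I : Set A) := by
  rintro x ⟨a, ha⟩
  obtain ⟨b, rfl⟩ := Submodule.mkQ_surjective W x
  exact (Submodule.Quotient.mk_eq_zero W).2 (h (Ideal.mul_mem_right b I ha))

/-- A homomorphism between cyclic modules generated by elements of a local corner. -/
theorem exists_of_hom_cyclic {e : A} (hdiag : ∀ a, ∃ c : k, e * a * e - c • e ∈ 𝔯)
    (hee : e * e = e) {W W' : Ideal A} (hW : 1 - e ∈ W) (hW' : 1 - e ∈ W')
    (F : (A ⧸ W) →ₗ[A] A ⧸ W') :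
    ∃ (c : k) (r : A), r ∈ 𝔯 ∧ e * r = r ∧ r * e = r ∧
      F (Submodule.mkQ W 1) = Submodule.mkQ W' (c • e + r) := by
  obtain ⟨a, ha⟩ := Submodule.mkQ_surjective W' (F (Submodule.mkQ W 1))
  obtain ⟨c, hc⟩ := hdiag a
  refine ⟨c, e * a * e - c • e, hc, ?_, ?_, ?_⟩
  · rw [mul_sub, mul_smul_comm, hee, ← mul_assoc, ← mul_assoc, hee]
  · rw [sub_mul, smul_mul_assoc, hee, mul_assoc, hee]
  · have h1 : Submodule.mkQ W 1 = e • Submodule.mkQ W 1 := by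
      rw [← map_smul]
      exact (Submodule.Quotient.eq W).2 (by simpa using hW)
    rw [h1, map_smul, ← ha, ← map_smul]
    refine (Submodule.Quotient.eq W').2 ?_
    have := Ideal.mul_mem_left W' (e * a) hW'
    convert this using 1
    rw [smul_eq_mul]
    noncomm_ring

/-- An endomorphism multiplies the generator by c e + r with r radical. Hence the l-th power of its
difference with c sends the generator to the class of r^l, which is zero. -/
theorem isIndecomposableModule_cyclic {e : A} (hdiag : ∀ a, ∃ c : k, e * a * e - c • e ∈ 𝔯)
    (hee : e * e = e) {W : Ideal A} (hW : 1 - e ∈ W) {l : ℕ} (hl : 𝔯 ^ l ≤ W) (he : e ∉ W) :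
    IsIndecomposableModule A (A ⧸ W) := by
  have : Nontrivial (A ⧸ W) := by
    refine Submodule.Quotient.nontrivial_iff.2 ?_
    rintro rfl
    exact he trivial
  refine isIndecomposableModule_of_end (k := k) fun f => ?_
  obtain ⟨c, r, hr, -, -, hf⟩ := exists_of_hom_cyclic hdiag hee hW hW f
  refine ⟨c, l, ?_⟩
  have h1 : (f - c • 1) (Submodule.mkQ W 1) = r • Submodule.mkQ W 1 := by
    rw [LinearMap.sub_apply, hf, LinearMap.smul_apply, Module.End.one_apply]
    have : c • Submodule.mkQ W 1 = Submodule.mkQ W (c • 1) := rfl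
    rw [this, ← map_sub, ← map_smul]
    refine (Submodule.Quotient.eq W).2 ?_
    have := Ideal.mul_mem_left W (algebraMap k A (-c)) hW
    convert this using 1
    rw [smul_eq_mul, mul_one, mul_sub, ← Algebra.smul_def, ← Algebra.smul_def]
    module
  have h2 : ∀ m, ((f - c • 1) ^ m) (Submodule.mkQ W 1) = r ^ m • Submodule.mkQ W 1 := by
    intro m
    induction m with
    | zero => simp
    | succ m ih => rw [pow_succ', Module.End.mul_apply, ih, map_smul, h1, smul_smul, pow_succ]
  ext
  change ((f - c • 1) ^ l) (Submodule.mkQ W 1) = 0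
  rw [h2, ← map_smul]
  refine (Submodule.Quotient.mk_eq_zero W).2 (hl ?_)
  simpa using pow_mem_jacobson_pow hr l

end Families

/-! ### Infinite dimensional mild algebras are prime -/

section Prime

variable {k : Type u} {A : Type v} [Field k] [Ring A] [Algebra k A]

local notation "𝔯" => Ring.jacobson A

theorem jacobson_pow_succ_le (l : ℕ) : 𝔯 ^ (l + 1) ≤ 𝔯 * 𝔯 ^ l := by
  rcases eq_or_ne l 0 with rfl | hl
  · intro a ha
    simpa using Ideal.mul_mem_mul (mem_jacobson_pow_one.1 ha) (mem_jacobson_pow_zero (1 : A))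
  · rw [Submodule.pow_succ' _ hl]

theorem mul_mem_sup_jacobson_pow {I : Ideal A} {l m : ℕ} {a b : A} (ha : a ∈ 𝔯 ^ l)
    (hb : b ∈ I ⊔ 𝔯 ^ m) : a * b ∈ I ⊔ 𝔯 ^ (l + m) := by
  obtain ⟨y, hy, z, hz, rfl⟩ := Submodule.mem_sup.1 hb
  rw [mul_add]
  exact add_mem (Submodule.mem_sup_left (Ideal.mul_mem_left _ _ hy))
    (Submodule.mem_sup_right (mul_mem_jacobson_pow_add ha hz))

instance {I J : Ideal A} [I.IsTwoSided] [J.IsTwoSided] : (I ⊔ J).IsTwoSided where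
  mul_mem_of_left b ha := by
    obtain ⟨y, hy, z, hz, rfl⟩ := Submodule.mem_sup.1 ha
    rw [add_mul]
    exact add_mem (Submodule.mem_sup_left (Ideal.mul_mem_right _ _ hy))
      (Submodule.mem_sup_right (Ideal.mul_mem_right _ _ hz))

/-- The closure of an ideal in the topology defined by the powers of the radical. -/
def Ideal.radicalClosure (I : Ideal A) : Ideal A := ⨅ l : ℕ, I ⊔ 𝔯 ^ l

theorem Ideal.mem_radicalClosure {I : Ideal A} {a : A} :
    a ∈ I.radicalClosure ↔ ∀ l : ℕ, a ∈ I ⊔ 𝔯 ^ l := by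
  simp [Ideal.radicalClosure, Submodule.mem_iInf]

instance {I : Ideal A} [I.IsTwoSided] : I.radicalClosure.IsTwoSided where
  mul_mem_of_left b ha := by
    rw [Ideal.mem_radicalClosure] at ha ⊢
    exact fun l => Ideal.mul_mem_right _ _ (ha l)

theorem Ideal.le_radicalClosure (I : Ideal A) : I ≤ I.radicalClosure :=
  le_iInf fun _ => le_sup_left

theorem Ideal.isRadicallyClosed_radicalClosure (I : Ideal A) :
    IsRadicallyClosed I.radicalClosure := by
  intro a ha
  rw [Ideal.mem_radicalClosure]
  intro l
  obtain ⟨b, hb, hab⟩ := ha l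
  simpa using add_mem (Submodule.mem_sup_right hab) (Ideal.mem_radicalClosure.1 hb l)

theorem sub_mul_mem_of_mem_span_sup {e : A} (hee : e * e = e) {J : Ideal A} [J.IsTwoSided] {x : A}
    (hx : x ∈ Ideal.span {1 - e} ⊔ J) : x * e ∈ J := by
  obtain ⟨y, hy, z, hz, rfl⟩ := Submodule.mem_sup.1 hx
  obtain ⟨c, rfl⟩ := Ideal.mem_span_singleton'.1 hy
  rw [add_mul, mul_assoc, sub_mul, one_mul, hee, sub_self, mul_zero, zero_add]
  exact Ideal.mul_mem_right _ _ hz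

variable {ι : Type w} [Fintype ι] {e : ι → A}

/-- In an infinite dimensional mild algebra nonzero closed ideals are open. -/
theorem exists_jacobson_pow_le_radicalClosure (h : IsAdmissibleAlgebra k A)
    (hm : IsMildAlgebra A) (he : IsPrimitiveSystem k e) {I : Ideal A} [I.IsTwoSided]
    (hI : I ≠ ⊥) : ∃ l : ℕ, 𝔯 ^ l ≤ I.radicalClosure := by
  set J := I.radicalClosure with hJ
  have hJ0 : J ≠ ⊥ := fun h0 => hI (eq_bot_iff.2 (h0 ▸ I.le_radicalClosure))
  have key : ∀ i, ∃ l : ℕ, ∀ r ∈ 𝔯 ^ l, r * e i ∈ J ⊔ 𝔯 ^ (l + 1) := by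
    intro i
    by_contra! hcon
    have hee : e i * e i = e i := he.complete.idem i
    -- The quotient by W l is A e_i modulo J e_i + R^(l+1) e_i.
    let W : ℕ → Ideal A := fun l => Ideal.span {1 - e i} ⊔ (J ⊔ 𝔯 ^ (l + 1))
    have hW1 : ∀ l, 1 - e i ∈ W l := fun l =>
      Submodule.mem_sup_left (Ideal.subset_span rfl)
    have hWl : ∀ l, 𝔯 ^ (l + 1) ≤ W l := fun l => le_sup_right.trans le_sup_right
    have heW : ∀ l, e i ∉ W l := by
      intro l hl
      obtain ⟨r, -, hr'⟩ := hcon l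
      have := sub_mul_mem_of_mem_span_sup hee hl
      rw [hee] at this
      exact hr' (Ideal.mul_mem_left _ _ this)
    -- For l < m the power R^m annihilates the l-th module; the element r of R^m supplied by `hcon`
    -- does not annihilate the m-th.
    have hlt : ∀ l m, l < m → ¬ Nonempty ((A ⧸ W l) ≃ₗ[A] A ⧸ W m) := by
      rintro l m hlm ⟨F⟩
      obtain ⟨r, hr, hr'⟩ := hcon m
      have h1 : r • F.symm (Submodule.mkQ _ (e i)) = 0 := by
        refine isTorsionBySet_quotient (hWl l) (a := ⟨r, ?_⟩)
        exact Ideal.pow_le_pow_right (by omega) hr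
      rw [← map_smul, map_eq_zero_iff _ F.symm.injective, ← map_smul] at h1
      have h2 := sub_mul_mem_of_mem_span_sup hee ((Submodule.Quotient.mk_eq_zero _).1 h1)
      rw [smul_eq_mul, mul_assoc, hee] at h2
      exact hr' h2
    have hfin : ∀ l, Module.Finite k (A ⧸ W l) := fun l => h.finite_quotient (hWl l)
    refine hm.false_of_family hJ0 I.isRadicallyClosed_radicalClosure (fun l : ℕ => A ⧸ W l)
      (fun l => isTorsionBySet_quotient (le_sup_left.trans le_sup_right))
      (fun l => isFiniteLength_of_finite k)
      (fun l => isIndecomposableModule_cyclic (he.diagonal i) hee (hW1 l) (hWl l) (heW l))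
      (fun l m hlm => ?_)
    rcases lt_trichotomy l m with hl | hl | hl
    · exact (hlt _ _ hl hlm).elim
    · exact hl
    · exact (hlt _ _ hl (hlm.map LinearEquiv.symm)).elim
  have persist : ∀ (i : ι) (l m : ℕ), (∀ r ∈ 𝔯 ^ l, r * e i ∈ J ⊔ 𝔯 ^ (l + 1)) →
      ∀ r ∈ 𝔯 ^ (m + l), r * e i ∈ J ⊔ 𝔯 ^ (m + l + 1) := by
    intro i l m hl
    induction m with
    | zero => simpa using hl
    | succ m ih =>
      intro r hr
      rw [add_right_comm] at hr
      refine Submodule.smul_induction_on (jacobson_pow_succ_le _ hr) (fun s hs t ht => ?_) (fun x y hx hy => ?_)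
      · rw [smul_eq_mul, mul_assoc]
        have := mul_mem_sup_jacobson_pow (mem_jacobson_pow_one.2 hs) (ih t ht)
        convert this using 3
        omega
      · rw [add_mul]
        exact add_mem hx hy
  choose L hL using key
  -- The sum is a common upper bound of the finitely many thresholds; by `persist` each inclusion
  -- survives beyond its threshold.
  set N := ∑ i, L i with hN
  have hstep : ∀ m, N ≤ m → 𝔯 ^ m ≤ J ⊔ 𝔯 ^ (m + 1) := by
    intro m hm r hr
    have : r = ∑ i, r * e i := by rw [← Finset.mul_sum, he.complete.complete, mul_one]
    rw [this]
    refine sum_mem fun i _ => ?_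
    have hi : L i ≤ m := (Finset.single_le_sum (f := L) (fun _ _ => Nat.zero_le _)
      (Finset.mem_univ i)).trans hm
    have := persist i (L i) (m - L i) (hL i)
    rw [Nat.sub_add_cancel hi] at this
    exact this r hr
  have hall : ∀ m, 𝔯 ^ N ≤ J ⊔ 𝔯 ^ (N + m) := by
    intro m
    induction m with
    | zero => exact le_sup_right
    | succ m ih => exact ih.trans (sup_le le_sup_left (hstep _ (by omega)))
  refine ⟨N, fun r hr => Ideal.mem_radicalClosure.2 fun l => ?_⟩
  have h1 : J ⊔ 𝔯 ^ (N + l) ≤ I ⊔ 𝔯 ^ l :=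
    sup_le (iInf_le _ l) ((Ideal.pow_le_pow_right (by omega)).trans le_sup_right)
  exact h1 (hall l hr)

/-- The two-sided ideal generated by an element. -/
def Ideal.twoSidedSpan (a : A) : Ideal A := Ideal.span (Set.range fun c => a * c)

instance (a : A) : (Ideal.twoSidedSpan a).IsTwoSided where
  mul_mem_of_left b hx := by
    induction hx using Submodule.span_induction with
    | mem x hx =>
      obtain ⟨c, rfl⟩ := hx
      exact Ideal.subset_span ⟨c * b, (mul_assoc _ _ _).symm⟩
    | zero => simp
    | add x y _ _ hx hy =>
      rw [add_mul]
      exact add_mem hx hy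
    | smul c x _ hx =>
      rw [smul_eq_mul, mul_assoc]
      exact Ideal.mul_mem_left _ _ hx

theorem Ideal.mem_twoSidedSpan_self (a : A) : a ∈ Ideal.twoSidedSpan a :=
  Ideal.subset_span ⟨1, mul_one a⟩

/-- This is primeness of A. If aAb = 0, the two-sided ideals of a and b annihilate each other, and
by separatedness so do the powers of R contained in their closures; then R is nilpotent and A finite
dimensional. -/
theorem exists_mul_mul_ne_zero (h : IsAdmissibleAlgebra k A) (hinf : ¬ Module.Finite k A)
    (hm : IsMildAlgebra A) (he : IsPrimitiveSystem k e) {a b : A} (ha : a ≠ 0) (hb : b ≠ 0) :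
    ∃ c, a * c * b ≠ 0 := by
  by_contra! hab
  have hne : ∀ a : A, a ≠ 0 → Ideal.twoSidedSpan a ≠ ⊥ := fun a ha h0 =>
    ha ((Ideal.mem_bot).1 (h0 ▸ Ideal.mem_twoSidedSpan_self a))
  obtain ⟨l, hl⟩ := exists_jacobson_pow_le_radicalClosure h hm he (hne a ha)
  obtain ⟨m, hm⟩ := exists_jacobson_pow_le_radicalClosure h hm he (hne b hb)
  have h1 : ∀ x ∈ Ideal.twoSidedSpan a, ∀ c, x * c * b = 0 := by
    intro x hx
    induction hx using Submodule.span_induction with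
    | mem x hx =>
      obtain ⟨d, rfl⟩ := hx
      intro c
      dsimp only
      rw [mul_assoc a, hab]
    | zero => simp
    | add x y _ _ hx hy => simp [add_mul, hx, hy]
    | smul d x _ hx => simp [mul_assoc] at hx ⊢; simp [hx]
  have h2 : ∀ r ∈ 𝔯 ^ l, ∀ c, r * c * b = 0 := by
    intro r hr c
    refine h.eq_zero fun n => ?_
    obtain ⟨y, hy, z, hz, rfl⟩ := Submodule.mem_sup.1 (Ideal.mem_radicalClosure.1 (hl hr) n)
    rw [add_mul, add_mul, h1 y hy, zero_add]
    exact mul_mem_jacobson_pow_right _ (mul_mem_jacobson_pow_right _ hz)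
  have h3 : ∀ y ∈ Ideal.twoSidedSpan b, ∀ r ∈ 𝔯 ^ l, r * y = 0 := by
    intro y hy
    induction hy using Submodule.span_induction with
    | mem x hx =>
      obtain ⟨d, rfl⟩ := hx
      intro r hr
      have := h2 r hr 1
      rw [mul_one] at this
      dsimp only
      rw [← mul_assoc, this, zero_mul]
    | zero => simp
    | add x y _ _ hx hy =>
      intro r hr
      rw [mul_add, hx r hr, hy r hr, add_zero]
    | smul d x _ hx =>
      intro r hr
      rw [smul_eq_mul, ← mul_assoc, hx _ (mul_mem_jacobson_pow_right d hr)]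
  have h4 : ∀ r ∈ 𝔯 ^ l, ∀ s ∈ 𝔯 ^ m, r * s = 0 := by
    intro r hr s hs
    refine h.eq_zero fun n => ?_
    obtain ⟨y, hy, z, hz, rfl⟩ := Submodule.mem_sup.1 (Ideal.mem_radicalClosure.1 (hm hs) n)
    rw [mul_add, h3 y hy r hr, zero_add]
    exact mul_mem_jacobson_pow_left _ hz
  have h5 : ∀ m, 𝔯 ^ (l + m) ≤ 𝔯 ^ l * 𝔯 ^ m := by
    intro m
    induction m with
    | zero =>
      intro r hr
      simpa using Ideal.mul_mem_mul hr (mem_jacobson_pow_zero (1 : A))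
    | succ m ih =>
      rw [← add_assoc, Submodule.pow_succ, Submodule.pow_succ, ← mul_assoc]
      exact Ideal.mul_mono ih le_rfl
  refine h.jacobson_pow_ne_bot hinf (l + m) (eq_bot_iff.2 ((h5 m).trans ?_))
  intro x hx
  refine Submodule.smul_induction_on hx (fun r hr s hs => ?_) (fun x y hx hy => add_mem hx hy)
  simpa using h4 r hr s hs

end Prime

/-! ### Corners of an infinite dimensional mild algebra -/

section Corner

variable {k : Type u} {A : Type v} [Field k] [Ring A] [Algebra k A]

local notation "𝔯" => Ring.jacobson A

theorem Ideal.smul_mem_of_algebra (I : Ideal A) (c : k) {a : A} (ha : a ∈ I) : c • a ∈ I := by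
  rw [Algebra.smul_def]
  exact I.mul_mem_left _ ha

variable {ι : Type w}

variable (k) in
/-- The Peirce component `e i * A * e j`. -/
def corner (e : ι → A) (i j : ι) : Submodule k A where
  carrier := {a | e i * a = a ∧ a * e j = a}
  zero_mem' := by simp
  add_mem' ha hb := ⟨by rw [mul_add, ha.1, hb.1], by rw [add_mul, ha.2, hb.2]⟩
  smul_mem' c a ha := ⟨by rw [mul_smul_comm, ha.1], by rw [smul_mul_assoc, ha.2]⟩

variable (k) in
/-- A primitive system of idempotents in an infinite dimensional mild admissible algebra. -/
structure IsMildSystem [Fintype ι] (e : ι → A) : Prop extends IsPrimitiveSystem k e where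
  admissible : IsAdmissibleAlgebra k A
  infinite : ¬ Module.Finite k A
  mild : IsMildAlgebra A

variable {e : ι → A}

theorem mul_mem_corner {i j l : ι} {a b : A} (ha : a ∈ corner k e i j) (hb : b ∈ corner k e j l) :
    a * b ∈ corner k e i l :=
  ⟨by rw [← mul_assoc, ha.1], by rw [mul_assoc, hb.2]⟩

variable [Fintype ι]

namespace IsPrimitiveSystem

variable (he : IsPrimitiveSystem k e)

include he

theorem idem (i : ι) : e i * e i = e i := he.complete.idem i

theorem mul_mul_mem_corner (i j : ι) (a : A) : e i * a * e j ∈ corner k e i j :=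
  ⟨by rw [← mul_assoc, ← mul_assoc, he.idem], by rw [mul_assoc, he.idem]⟩

theorem self_mem_corner (i : ι) : e i ∈ corner k e i i := ⟨he.idem i, he.idem i⟩

theorem ne_zero (i : ι) : e i ≠ 0 := fun h0 => he.notMem i (h0 ▸ zero_mem _)

theorem mem_jacobson_of_mem_corner {i j : ι} (hij : i ≠ j) {a : A} (ha : a ∈ corner k e i j) :
    a ∈ 𝔯 := by
  have := he.off_diagonal hij a
  rwa [ha.1, ha.2] at this

theorem exists_sub_smul_mem {i : ι} {a : A} (ha : a ∈ corner k e i i) :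
    ∃ c : k, a - c • e i ∈ 𝔯 := by
  have := he.diagonal i a
  rwa [ha.1, ha.2] at this

theorem exists_eq_smul_add {i : ι} {a : A} (ha : a ∈ corner k e i i) :
    ∃ (c : k) (r : A), r ∈ corner k e i i ∧ r ∈ 𝔯 ∧ a = c • e i + r := by
  obtain ⟨c, hc⟩ := he.exists_sub_smul_mem ha
  exact ⟨c, a - c • e i, sub_mem ha (Submodule.smul_mem _ _ (he.self_mem_corner i)), hc, by simp⟩

/-- The corner is local: a = c e_i + r with c ≠ 0, and the inverse of 1 + c⁻¹ r in A is cut down to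
the corner. -/
theorem exists_inverse {i : ι} {a : A} (ha : a ∈ corner k e i i) (har : a ∉ 𝔯) :
    ∃ b ∈ corner k e i i, b ∉ 𝔯 ∧ a * b = e i ∧ b * a = e i := by
  obtain ⟨c, r, hr, hrr, rfl⟩ := he.exists_eq_smul_add ha
  have hc : c ≠ 0 := by
    rintro rfl
    simp [hrr] at har
  have hs : c⁻¹ • r ∈ 𝔯 := Ideal.smul_mem_of_algebra _ _ hrr
  obtain ⟨b, hb, hb'⟩ := exists_inverse_one_add hs
  have hcomm : c • e i + r = c • (e i * (1 + c⁻¹ • r)) := by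
    rw [mul_add, mul_one, mul_smul_comm, hr.1, smul_add, smul_smul, mul_inv_cancel₀ hc, one_smul]
  have hcomm' : c • e i + r = c • ((1 + c⁻¹ • r) * e i) := by
    rw [add_mul, one_mul, smul_mul_assoc, hr.2, smul_add, smul_smul, mul_inv_cancel₀ hc, one_smul]
  have h1 : (c • e i + r) * (e i * (c⁻¹ • b) * e i) = e i := by
    rw [← mul_assoc, ← mul_assoc, ha.2, hcomm]
    rw [smul_mul_assoc, mul_smul_comm, smul_smul, mul_inv_cancel₀ hc, one_smul, mul_assoc (e i), hb,
      mul_one, he.idem]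
  have h2 : (e i * (c⁻¹ • b) * e i) * (c • e i + r) = e i := by
    rw [mul_assoc, ha.1, hcomm']
    rw [mul_smul_comm, mul_smul_comm, smul_mul_assoc, smul_smul, mul_inv_cancel₀ hc, one_smul,
      mul_assoc, ← mul_assoc b, hb', one_mul, he.idem]
  refine ⟨e i * (c⁻¹ • b) * e i, he.mul_mul_mem_corner _ _ _, fun hmem => ?_, h1, h2⟩
  exact he.notMem i (h1 ▸ Ideal.mul_mem_left _ _ hmem)

end IsPrimitiveSystem

namespace IsMildSystem

variable (S : IsMildSystem k e)

include S

theorem exists_mul_corner_mul_ne_zero {i j l m : ι} {a b : A} (ha : a ∈ corner k e i j)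
    (hb : b ∈ corner k e l m) (ha0 : a ≠ 0) (hb0 : b ≠ 0) :
    ∃ c ∈ corner k e j l, a * c * b ≠ 0 := by
  obtain ⟨c, hc⟩ := exists_mul_mul_ne_zero S.admissible S.infinite S.mild S.toIsPrimitiveSystem
    ha0 hb0
  refine ⟨e j * c * e l, S.mul_mul_mem_corner _ _ _, ?_⟩
  rw [← mul_assoc, ← mul_assoc, ha.2, mul_assoc, hb.1]
  exact hc

theorem exists_corner_ne_zero (i j : ι) : ∃ c ∈ corner k e i j, c ≠ 0 := by
  obtain ⟨c, hc, hc'⟩ := S.exists_mul_corner_mul_ne_zero (S.self_mem_corner i) (S.self_mem_corner j)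
    (S.ne_zero i) (S.ne_zero j)
  rw [hc.1, hc.2] at hc'
  exact ⟨c, hc, hc'⟩

/-- The contradiction comes from the modules A e_i / (relation a = t b, modulo N), t ∈ k. Since N
absorbs products of two radical elements of the corner, an isomorphism acts on a and b as a scalar,
which preserves the ratio t. -/
theorem eq_zero_of_two_independent [Infinite k] {i : ι} {N : Ideal A} {l : ℕ} (hl : 𝔯 ^ l ≤ N)
    (hN : ∀ x ∈ N, x * e i ∈ N)
    (hJ : ∀ s ∈ corner k e i i, s ∈ 𝔯 → ∀ t ∈ corner k e i i, t ∈ 𝔯 → s * t ∈ N)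
    {a b : A} (ha : a ∈ corner k e i i) (har : a ∈ 𝔯) (hb : b ∈ corner k e i i) (hbr : b ∈ 𝔯)
    (hab : ∀ c d : k, c • a + d • b ∈ N → c = 0 ∧ d = 0) : False := by
  let W : k → Ideal A := fun t => Ideal.span {1 - e i} ⊔ (Ideal.span {a - t • b} ⊔ N)
  have hW1 : ∀ t, 1 - e i ∈ W t := fun t => Submodule.mem_sup_left (Ideal.subset_span rfl)
  have hNW : ∀ t, N ≤ W t := fun t => le_sup_right.trans le_sup_right
  have hWab : ∀ t, a - t • b ∈ W t := fun t =>
    Submodule.mem_sup_right (Submodule.mem_sup_left (Ideal.subset_span rfl))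
  have hab' : ∀ t : k, a - t • b ∈ corner k e i i := fun t =>
    sub_mem ha (Submodule.smul_mem _ _ hb)
  have habr : ∀ t : k, a - t • b ∈ 𝔯 := fun t => Submodule.sub_mem 𝔯 har (Ideal.smul_mem_of_algebra _ _ hbr)
  -- Within the corner, W t is only the line through a − t b modulo N, because radical multiples of
  -- a − t b already lie in N.
  have hmem : ∀ t x, x ∈ corner k e i i → x ∈ W t → ∃ c : k, x - c • (a - t • b) ∈ N := by
    intro t x hx hxW
    change x ∈ Ideal.span {1 - e i} ⊔ (Ideal.span {a - t • b} ⊔ N) at hxW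
    obtain ⟨y, hy, z', hz', rfl⟩ := Submodule.mem_sup.1 hxW
    obtain ⟨p, rfl⟩ := Ideal.mem_span_singleton'.1 hy
    obtain ⟨z, hz, n, hn, rfl⟩ := Submodule.mem_sup.1 hz'
    obtain ⟨q, rfl⟩ := Ideal.mem_span_singleton'.1 hz
    obtain ⟨c, r, hr, hrr, hqr⟩ := S.exists_eq_smul_add (S.mul_mul_mem_corner i i q)
    refine ⟨c, ?_⟩
    have h1 : p * (1 - e i) + (q * (a - t • b) + n) - c • (a - t • b) =
        r * (a - t • b) + e i * (n * e i) := by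
      conv_lhs => rw [← hx.2, ← hx.1]
      rw [mul_assoc (e i), add_mul, mul_assoc p, sub_mul, S.idem, one_mul, sub_self, mul_zero, zero_add, add_mul,
        mul_assoc q, (hab' t).2, mul_add]
      have : e i * (q * (a - t • b)) = (c • e i + r) * (a - t • b) := by
        rw [← hqr, mul_assoc, (hab' t).1, mul_assoc]
      rw [this, add_mul, smul_mul_assoc, (hab' t).1]
      abel
    rw [h1]
    exact add_mem (hJ _ hr hrr _ (hab' t) (habr t)) (Ideal.mul_mem_left _ _ (hN n hn))
  have hbN : b ∉ N := fun h0 => one_ne_zero (hab 0 1 (by simpa using h0)).2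
  have heW : ∀ t, e i ∉ W t := by
    intro t ht
    obtain ⟨c, hc⟩ := hmem t _ (S.self_mem_corner i) ht
    have h1 := Ideal.mul_mem_left N b hc
    rw [mul_sub, hb.2, mul_smul_comm] at h1
    have h2 : c • (b * (a - t • b)) ∈ N :=
      Ideal.smul_mem_of_algebra _ _ (hJ b hb hbr _ (hab' t) (habr t))
    exact hbN (by simpa using add_mem h1 h2)
  have hfin : ∀ t, Module.Finite k (A ⧸ W t) := fun t => S.admissible.finite_quotient
    (hl.trans (hNW t))
  refine S.mild.false_of_family (I := 𝔯 ^ l) (S.admissible.jacobson_pow_ne_bot S.infinite l)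
    (isRadicallyClosed_of_jacobson_pow_le le_rfl) (fun t : k => A ⧸ W t)
    (fun t => isTorsionBySet_quotient (hl.trans (hNW t)))
    (fun t => isFiniteLength_of_finite k)
    (fun t => isIndecomposableModule_cyclic (S.diagonal i) (S.idem i) (hW1 t)
      (hl.trans (hNW t)) (heW t))
    ?_
  rintro t t' ⟨F⟩
  obtain ⟨c, r, hrr, hr1, hr2, hF⟩ := exists_of_hom_cyclic (S.diagonal i) (S.idem i) (hW1 t)
    (hW1 t') F.toLinearMap
  have hr : r ∈ corner k e i i := ⟨hr1, hr2⟩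
  have hFx : ∀ x ∈ corner k e i i, x ∈ 𝔯 →
      F (Submodule.mkQ _ x) = Submodule.mkQ _ (c • x + x * r) := by
    intro x hx _
    have : Submodule.mkQ (W t) x = x • Submodule.mkQ (W t) 1 := by
      rw [← map_smul, smul_eq_mul, mul_one]
    rw [this, map_smul]
    have hF' : F (Submodule.mkQ (W t) 1) = Submodule.mkQ (W t') (c • e i + r) := hF
    rw [hF', ← map_smul, smul_eq_mul, mul_add, mul_smul_comm, hx.2]
  -- If c = 0, then b maps to b r, which lies in N, so injectivity makes b a multiple of a − t b
  -- modulo N, against independence.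
  have hc : c ≠ 0 := by
    rintro rfl
    have h1 := hFx b hb hbr
    rw [zero_smul, zero_add, (Submodule.Quotient.mk_eq_zero (W t')).2
      (hNW _ (hJ b hb hbr r hr hrr)) |> (id : Submodule.mkQ (W t') (b * r) = 0 → _)] at h1
    have h2 : b ∈ W t := (Submodule.Quotient.mk_eq_zero _).1 ((map_eq_zero_iff F F.injective).1 h1)
    obtain ⟨d, hd⟩ := hmem t b hb h2
    have h3 := hab (-d) (1 + d * t) (by
      convert hd using 1
      module)
    have : d = 0 := by simpa using h3.1
    rw [this] at h3
    simp at h3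
  have h1 := hFx _ (hab' t) (habr t)
  rw [(Submodule.Quotient.mk_eq_zero (W t)).2 (hWab t) |>
    (id : Submodule.mkQ (W t) (a - t • b) = 0 → _), map_zero] at h1
  have h2 := (Submodule.Quotient.mk_eq_zero (W t')).1 h1.symm
  have h3 : c • (a - t • b) ∈ W t' := by
    have := sub_mem h2 (hNW _ (hJ _ (hab' t) (habr t) r hr hrr))
    simpa using this
  -- Comparing coefficients in c(a − t b) ≡ d(a − t' b) modulo N gives c = d and c t = d t'.
  obtain ⟨d, hd⟩ := hmem t' _ (Submodule.smul_mem _ _ (hab' t)) h3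
  have h4 := hab (c - d) (d * t' - c * t) (by
    convert hd using 1
    module)
  have hcd : c = d := sub_eq_zero.1 h4.1
  subst hcd
  have := h4.2
  rw [← mul_sub, mul_eq_zero, sub_eq_zero] at this
  exact (this.resolve_left hc).symm

end IsMildSystem

end Corner

/-! ### The local corners are discrete valuation rings -/

section LocalCorner

variable {k : Type u} {A : Type v} [Field k] [Ring A] [Algebra k A] {ι : Type w} {e : ι → A}

local notation "𝔯" => Ring.jacobson A

variable (k A) in
/-- The powers of the radical as subspaces. -/
def radicalPow (l : ℕ) : Submodule k A := (𝔯 ^ l).restrictScalars k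

theorem mem_radicalPow {l : ℕ} {a : A} : a ∈ radicalPow k A l ↔ a ∈ 𝔯 ^ l := Iff.rfl

theorem radicalPow_anti {l m : ℕ} (h : l ≤ m) : radicalPow k A m ≤ radicalPow k A l :=
  fun _ ha => Ideal.pow_le_pow_right h ha

theorem mul_radicalPow_le (P : Submodule k A) (l : ℕ) :
    P * radicalPow k A l ≤ radicalPow k A l :=
  Submodule.mul_le.2 fun _ _ _ hb => mul_mem_jacobson_pow_left _ hb

theorem radicalPow_mul_le (P : Submodule k A) (l : ℕ) :
    radicalPow k A l * P ≤ radicalPow k A l :=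
  Submodule.mul_le.2 fun _ ha _ _ => mul_mem_jacobson_pow_right _ ha

variable (k) in
/-- The radical of a local corner. -/
def cornerRadical (e : ι → A) (i : ι) : Submodule k A :=
  corner k e i i ⊓ Submodule.restrictScalars k 𝔯

theorem cornerRadical_pow_le (i : ι) (l : ℕ) :
    cornerRadical k e i ^ (l + 1) ≤ radicalPow k A (l + 1) := by
  induction l with
  | zero =>
    rw [zero_add, Submodule.pow_one]
    exact fun a ha => mem_jacobson_pow_one.2 ha.2
  | succ l ih =>
    rw [Submodule.pow_succ]
    exact Submodule.mul_le.2 fun a ha b hb =>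
      mul_mem_jacobson_pow_add (ih ha) (mem_jacobson_pow_one.2 hb.2)

namespace IsMildSystem

variable [Fintype ι] (S : IsMildSystem k e)

include S

/-- The radical J of the corner is generated by one element modulo J^2, approximately but with x
independent of the precision l. Any x outside J^2 + R^l₀ works, as a further y would be independent
of it modulo J^2 and a power of R. -/
theorem exists_le_span_sup_mul [Infinite k] (i : ι) : ∃ x ∈ cornerRadical k e i, ∀ l,
    cornerRadical k e i ≤
      Submodule.span k {x} ⊔ cornerRadical k e i * cornerRadical k e i ⊔ radicalPow k A l := by
  set J := cornerRadical k e i with hJ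
  by_cases hcase : ∀ l, J ≤ J * J ⊔ radicalPow k A l
  · exact ⟨0, zero_mem _, fun l => (hcase l).trans (sup_le_sup_right le_sup_right _)⟩
  push Not at hcase
  obtain ⟨l₀, hl₀⟩ := hcase
  obtain ⟨x, hx, hxl⟩ := Set.not_subset.1 hl₀
  refine ⟨x, hx, fun l y hy => ?_⟩
  by_contra hyl
  set P := J * J ⊔ radicalPow k A (max l l₀) with hP
  have hP1 : P ≤ J * J ⊔ radicalPow k A l₀ :=
    sup_le_sup_left (radicalPow_anti (le_max_right _ _)) _
  have hP2 : P ≤ J * J ⊔ radicalPow k A l :=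
    sup_le_sup_left (radicalPow_anti (le_max_left _ _)) _
  -- P is merely a subspace; N is the left ideal of those a with e_i A a e_i inside P, and it meets
  -- the corner within P.
  let N : Ideal A :=
    { carrier := {a | ∀ s, e i * s * a * e i ∈ P}
      zero_mem' := fun s => by simp
      add_mem' := fun {a b} ha hb s => by
        rw [mul_add, add_mul]
        exact add_mem (ha s) (hb s)
      smul_mem' := fun c a ha s => by
        have := ha (s * c)
        rwa [← mul_assoc (e i), mul_assoc _ c] at this }
  have hNP : ∀ a ∈ corner k e i i, a ∈ N → a ∈ P := by
    intro a ha haN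
    have := haN 1
    rwa [mul_one, ha.1, ha.2] at this
  refine S.eq_zero_of_two_independent (i := i) (N := N) (l := max l l₀) ?_ ?_ ?_ hy.1 hy.2 hx.1 hx.2
    ?_
  · intro a ha s
    exact Submodule.mem_sup_right
      (mul_mem_jacobson_pow_right _ (mul_mem_jacobson_pow_left _ ha))
  · intro a ha s
    have := ha s
    rwa [← mul_assoc, mul_assoc _ (e i), S.idem]
  · intro s hs hsr t ht htr a
    refine Submodule.mem_sup_left ?_
    have : e i * a * (s * t) * e i = (e i * a * e i * s) * t := by
      rw [mul_assoc _ (s * t), mul_assoc s, ht.2, ← mul_assoc, mul_assoc _ (e i), hs.1]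
    rw [this]
    exact Submodule.mul_mem_mul
      ⟨mul_mem_corner (S.mul_mul_mem_corner i i a) hs, Ideal.mul_mem_left _ _ hsr⟩ ⟨ht, htr⟩
  · intro c d hcd
    have h1 : c • y + d • x ∈ P := hNP _ (add_mem (Submodule.smul_mem _ _ hy.1)
      (Submodule.smul_mem _ _ hx.1)) hcd
    have hc : c = 0 := by
      by_contra hc
      apply hyl
      have h2 : c • y ∈ Submodule.span k {x} ⊔ J * J ⊔ radicalPow k A l := by
        have h3 : d • x ∈ Submodule.span k {x} ⊔ J * J ⊔ radicalPow k A l :=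
          Submodule.mem_sup_left (Submodule.mem_sup_left
            (Submodule.smul_mem _ _ (Submodule.mem_span_singleton_self x)))
        have h4 : c • y + d • x ∈ Submodule.span k {x} ⊔ J * J ⊔ radicalPow k A l :=
          (sup_le_sup_right le_sup_right _ : J * J ⊔ radicalPow k A l ≤ _) (hP2 h1)
        simpa using sub_mem h4 h3
      simpa [smul_smul, inv_mul_cancel₀ hc] using Submodule.smul_mem _ c⁻¹ h2
    refine ⟨hc, ?_⟩
    by_contra hd
    apply hxl
    rw [hc, zero_smul, zero_add] at h1
    simpa [smul_smul, inv_mul_cancel₀ hd] using Submodule.smul_mem _ d⁻¹ (hP1 h1)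

/-- Iterating J ⊆ kx + J^2 gives J^m ⊆ k x^m + J^(m+1) up to R^l, and J^(l+1) lies in R^(l+1). -/
theorem exists_le_span_powers [Infinite k] (i : ι) : ∃ x ∈ cornerRadical k e i, ∀ l,
    cornerRadical k e i ≤
      Submodule.span k (Set.range fun m : ℕ => x ^ (m + 1)) ⊔ radicalPow k A l := by
  obtain ⟨x, hx, hxl⟩ := S.exists_le_span_sup_mul i
  refine ⟨x, hx, fun l => ?_⟩
  set J := cornerRadical k e i with hJ
  set T := Submodule.span k (Set.range fun m : ℕ => x ^ (m + 1)) with hT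
  have hpow : ∀ m, x ^ (m + 1) ∈ J ^ (m + 1) := fun m => Submodule.pow_mem_pow _ hx _
  have key : ∀ m, J ^ (m + 1) ≤ Submodule.span k {x ^ (m + 1)} ⊔ J ^ (m + 2) ⊔ radicalPow k A l := by
    intro m
    induction m with
    | zero => simpa [pow_two] using hxl l
    | succ m ih =>
      have h1 : Submodule.span k {x ^ (m + 1)} * J ≤
          Submodule.span k {x ^ (m + 2)} ⊔ J ^ (m + 3) ⊔ radicalPow k A l := by
        refine (mul_le_mul' le_rfl (hxl l)).trans ?_
        rw [Submodule.mul_sup, Submodule.mul_sup]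
        refine sup_le_sup (sup_le_sup ?_ ?_) (mul_radicalPow_le _ _)
        · rw [Submodule.span_mul_span, Set.singleton_mul_singleton, ← pow_succ]
        · rw [pow_succ J (m + 2), pow_succ J (m + 1), mul_assoc]
          refine mul_le_mul' ?_ le_rfl
          rw [Submodule.span_singleton_le_iff_mem]
          exact hpow m
      calc J ^ (m + 1 + 1) = J ^ (m + 1) * J := pow_succ _ _
        _ ≤ (Submodule.span k {x ^ (m + 1)} ⊔ J ^ (m + 2) ⊔ radicalPow k A l) * J :=
          mul_le_mul' ih le_rfl
        _ ≤ _ := by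
          rw [Submodule.sup_mul, Submodule.sup_mul]
          refine sup_le (sup_le h1 ?_) ((radicalPow_mul_le _ _).trans le_sup_right)
          rw [← pow_succ]
          exact le_sup_right.trans le_sup_left
  have hall : ∀ m, J ≤ T ⊔ J ^ (m + 1) ⊔ radicalPow k A l := by
    intro m
    induction m with
    | zero => simpa using le_sup_right.trans le_sup_left
    | succ m ih =>
      refine ih.trans (sup_le (sup_le (le_sup_left.trans le_sup_left) ((key m).trans ?_))
        le_sup_right)
      refine sup_le_sup_right (sup_le_sup_right ?_ _) _
      rw [Submodule.span_singleton_le_iff_mem]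
      exact Submodule.subset_span ⟨m, rfl⟩
  refine (hall l).trans (sup_le (sup_le le_sup_left ?_) le_sup_right)
  exact (cornerRadical_pow_le i l).trans ((radicalPow_anti (Nat.le_succ l)).trans le_sup_right)

/-- Polynomials in x without constant term are dense in the radical of the corner, and they commute;
the scalar multiples of e_i are central there. -/
theorem corner_mul_comm [Infinite k] {i : ι} {a b : A} (ha : a ∈ corner k e i i)
    (hb : b ∈ corner k e i i) : a * b = b * a := by
  obtain ⟨x, hx, hxl⟩ := S.exists_le_span_powers i
  have hT : ∀ s ∈ Submodule.span k (Set.range fun m : ℕ => x ^ (m + 1)),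
      ∀ t ∈ Submodule.span k (Set.range fun m : ℕ => x ^ (m + 1)), s * t = t * s := by
    intro s hs t ht
    refine Submodule.span_induction₂ (p := fun s t _ _ => s * t = t * s) ?_ ?_ ?_ ?_ ?_ ?_ ?_ hs ht
    · rintro _ _ ⟨m, rfl⟩ ⟨n, rfl⟩
      exact (pow_mul_comm x _ _)
    · simp
    · simp
    · intro x y z _ _ _ h1 h2
      rw [add_mul, mul_add, h1, h2]
    · intro x y z _ _ _ h1 h2
      rw [add_mul, mul_add, h1, h2]
    · intro c x y _ _ h1
      rw [smul_mul_assoc, mul_smul_comm, h1]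
    · intro c x y _ _ h1
      rw [smul_mul_assoc, mul_smul_comm, h1]
  have hJ : ∀ a ∈ cornerRadical k e i, ∀ b ∈ cornerRadical k e i, a * b = b * a := by
    intro a ha b hb
    refine S.admissible.eq_of_sub_mem fun l => ?_
    obtain ⟨s, hs, r, hr, rfl⟩ := Submodule.mem_sup.1 (hxl l ha)
    obtain ⟨t, ht, q, hq, rfl⟩ := Submodule.mem_sup.1 (hxl l hb)
    have : (s + r) * (t + q) - (t + q) * (s + r) =
        s * q + r * (t + q) - (t * r + q * (s + r)) := by
      rw [add_mul, mul_add, hT s hs t ht]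
      noncomm_ring
    rw [this]
    exact sub_mem
      (add_mem (mul_mem_jacobson_pow_left _ hq) (mul_mem_jacobson_pow_right _ hr))
      (add_mem (mul_mem_jacobson_pow_left _ hr) (mul_mem_jacobson_pow_right _ hq))
  obtain ⟨c, r, hr, hrr, rfl⟩ := S.exists_eq_smul_add ha
  obtain ⟨d, q, hq, hqr, rfl⟩ := S.exists_eq_smul_add hb
  simp only [add_mul, mul_add, smul_mul_assoc, mul_smul_comm, hr.1, hr.2, hq.1, hq.2,
    hJ r ⟨hr, hrr⟩ q ⟨hq, hqr⟩]
  module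

theorem local_mul_ne_zero [Infinite k] {i : ι} {a b : A} (ha : a ∈ corner k e i i)
    (hb : b ∈ corner k e i i) (ha0 : a ≠ 0) (hb0 : b ≠ 0) : a * b ≠ 0 := by
  obtain ⟨c, hc, hc'⟩ := S.exists_mul_corner_mul_ne_zero ha hb ha0 hb0
  intro h0
  rw [S.corner_mul_comm ha hc, mul_assoc, h0, mul_zero] at hc'
  exact hc' rfl

theorem exists_mem_cornerRadical_ne_zero (i : ι) : ∃ a ∈ cornerRadical k e i, a ≠ 0 := by
  obtain ⟨r, hr, hr0⟩ := Submodule.exists_mem_ne_zero_of_ne_bot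
    (S.admissible.jacobson_pow_ne_bot S.infinite 1)
  rw [mem_jacobson_pow_one] at hr
  obtain ⟨c, hc⟩ := exists_mul_mul_ne_zero S.admissible S.infinite S.mild S.toIsPrimitiveSystem
    (S.ne_zero i) hr0
  obtain ⟨d, hd⟩ := exists_mul_mul_ne_zero S.admissible S.infinite S.mild S.toIsPrimitiveSystem
    hc (S.ne_zero i)
  refine ⟨_, ⟨?_, ?_⟩, hd⟩
  · have := S.mul_mul_mem_corner i i (c * r * d)
    simp only [mul_assoc] at this ⊢
    exact this
  · exact Ideal.mul_mem_right _ _ (Ideal.mul_mem_right _ _ (Ideal.mul_mem_left _ _ hr))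

end IsMildSystem

end LocalCorner

/-! ### Divisibility and uniformizers in the local corners -/

section Uniformizer

variable {k : Type u} {A : Type v} [Field k] [Ring A] [Algebra k A] {ι : Type w} {e : ι → A}

local notation "𝔯" => Ring.jacobson A

namespace IsMildSystem

variable [Fintype ι] (S : IsMildSystem k e)

include S

/-- The factor e_i matters for m = 0, where x^0 is the unit of A and not of the corner. -/
theorem corner_pow_ne_zero [Infinite k] {i : ι} {x : A} (hx : x ∈ corner k e i i) (hx0 : x ≠ 0)
    (m : ℕ) : e i * x ^ m ∈ corner k e i i ∧ e i * x ^ m ≠ 0 := by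
  induction m with
  | zero => simpa using ⟨S.self_mem_corner i, S.ne_zero i⟩
  | succ m ih =>
    rw [pow_succ, ← mul_assoc]
    exact ⟨mul_mem_corner ih.1 hx, S.local_mul_ne_zero ih.1 hx ih.2 hx0⟩

theorem mul_corner_pow_mem [Infinite k] {i : ι} {x a : A} (hx : x ∈ corner k e i i) (hx0 : x ≠ 0)
    (ha : a ∈ corner k e i i) (m : ℕ) : a * x ^ m ∈ corner k e i i := by
  have := mul_mem_corner ha (S.corner_pow_ne_zero hx hx0 m).1
  rwa [← mul_assoc, ha.2] at this

/-- Elements of a high power of the radical are approximately divisible by a given power. -/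
theorem exists_jacobson_pow_divisible [Infinite k] {i : ι} {x : A} (hx : x ∈ corner k e i i)
    (hx0 : x ≠ 0) (m : ℕ) : ∃ n : ℕ, ∀ y ∈ corner k e i i, y ∈ 𝔯 ^ n →
      ∀ l, ∃ a ∈ corner k e i i, y - a * x ^ m ∈ 𝔯 ^ l := by
  obtain ⟨hz, hz0⟩ := S.corner_pow_ne_zero hx hx0 m
  set z := e i * x ^ m with hz'
  -- The closure of AzA contains some R^n. Cutting AzA down to the corner leaves only multiples of
  -- x^m, since the corner is commutative.
  obtain ⟨n, hn⟩ := exists_jacobson_pow_le_radicalClosure S.admissible S.mild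
    S.toIsPrimitiveSystem (I := Ideal.twoSidedSpan z) (fun h0 => hz0
      ((Ideal.mem_bot).1 (h0 ▸ Ideal.mem_twoSidedSpan_self z)))
  have hspan : ∀ y ∈ Ideal.twoSidedSpan z, ∀ s, ∃ a ∈ corner k e i i,
      e i * s * y * e i = a * x ^ m := by
    intro y hy
    induction hy using Submodule.span_induction with
    | mem y hy =>
      obtain ⟨c, rfl⟩ := hy
      intro s
      refine ⟨(e i * c * e i) * (e i * s * e i), mul_mem_corner (S.mul_mul_mem_corner i i c)
        (S.mul_mul_mem_corner i i s), ?_⟩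
      have h1 : e i * s * (z * c) * e i = (e i * s * e i) * z * (e i * c * e i) := by
        conv_lhs => rw [← hz.1, ← hz.2]
        noncomm_ring
      dsimp only
      rw [h1, S.corner_mul_comm (mul_mem_corner (S.mul_mul_mem_corner i i s) hz)
        (S.mul_mul_mem_corner i i c), hz', ← mul_assoc (e i * s * e i) (e i),
        (S.mul_mul_mem_corner i i s).2, ← mul_assoc]
    | zero => exact fun s => ⟨0, zero_mem _, by simp⟩
    | add y y' _ _ h1 h2 =>
      intro s
      obtain ⟨a, ha, ha'⟩ := h1 s
      obtain ⟨b, hb, hb'⟩ := h2 s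
      exact ⟨a + b, add_mem ha hb, by rw [mul_add, add_mul, ha', hb', add_mul]⟩
    | smul c y _ h1 =>
      intro s
      obtain ⟨a, ha, ha'⟩ := h1 (s * c)
      refine ⟨a, ha, ?_⟩
      rw [← ha', smul_eq_mul]
      noncomm_ring
  refine ⟨n, fun y hy hyn l => ?_⟩
  obtain ⟨p, hp, q, hq, hpq⟩ := Submodule.mem_sup.1 (Ideal.mem_radicalClosure.1 (hn hyn) l)
  obtain ⟨a, ha, ha'⟩ := hspan p hp 1
  refine ⟨a, ha, ?_⟩
  have : y - a * x ^ m = e i * q * e i := by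
    rw [← ha']
    conv_lhs => rw [← hy.2, ← hy.1, ← hpq]
    noncomm_ring
  rw [this]
  exact mul_mem_jacobson_pow_right _ (mul_mem_jacobson_pow_left _ hq)

/-- The multiples of a power of a radical element of a local corner form a closed subset. -/
theorem exists_eq_mul_pow [Infinite k] {i : ι} {x : A} (hx : x ∈ corner k e i i) (hxr : x ∈ 𝔯)
    (hx0 : x ≠ 0) {n : ℕ} {y : A} (hy : y ∈ corner k e i i)
    (hyn : ∀ l, ∃ a ∈ corner k e i i, y - a * x ^ n ∈ 𝔯 ^ l) :
    ∃ a ∈ corner k e i i, y = a * x ^ n := by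
  -- C m is the closure of the multiples of x^m in the corner. Subtracting a suitable a x^m from an
  -- element of C m leaves a remainder so deep in the radical filtration that it lies in C (m + 1);
  -- the coefficients sum to a convergent series.
  let C : ℕ → Type v := fun m => {y : A // y ∈ corner k e i i ∧
    ∀ l, ∃ a ∈ corner k e i i, y - a * x ^ m ∈ 𝔯 ^ l}
  have hC : ∀ m (y : C m), y.1 ∈ 𝔯 ^ m := by
    intro m y
    obtain ⟨a, -, ha⟩ := y.2.2 m
    simpa using add_mem ha (mul_mem_jacobson_pow_left a (pow_mem_jacobson_pow hxr m))
  have hstep : ∀ m (y : C m), ∃ (a : A) (z : C (m + 1)),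
      a ∈ corner k e i i ∧ z.1 = y.1 - a * x ^ m := by
    intro m y
    obtain ⟨N, hN⟩ := S.exists_jacobson_pow_divisible hx hx0 (m + 1)
    obtain ⟨a, ha, ha'⟩ := y.2.2 N
    have hmem : y.1 - a * x ^ m ∈ corner k e i i :=
      sub_mem y.2.1 (S.mul_corner_pow_mem hx hx0 ha m)
    exact ⟨a, ⟨_, hmem, hN _ hmem ha'⟩, ha, rfl⟩
  choose a z ha hz using hstep
  let Y : ∀ m, C (n + m) := fun m => Nat.rec ⟨y, hy, hyn⟩ (fun m t => z (n + m) t) m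
  have hY : ∀ m, (Y (m + 1)).1 = (Y m).1 - a (n + m) (Y m) * x ^ (n + m) := fun m => hz _ (Y m)
  obtain ⟨s, hs⟩ := S.admissible.exists_sum (fun m => a (n + m) (Y m) * x ^ m)
    (fun m => mul_mem_jacobson_pow_left _ (pow_mem_jacobson_pow hxr m))
  have hsum : ∀ m, (Y m).1 = y - (∑ j ∈ Finset.range m, a (n + j) (Y j) * x ^ j) * x ^ n := by
    intro m
    induction m with
    | zero => simp [Y]
    | succ m ih =>
      rw [hY, ih, Finset.sum_range_succ, add_mul, sub_sub, mul_assoc, ← pow_add, add_comm m n]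
  have hy' : y = s * x ^ n := by
    refine S.admissible.eq_of_sub_mem fun l => ?_
    have h1 : y - s * x ^ n = (Y l).1 -
        (s - ∑ j ∈ Finset.range l, a (n + j) (Y j) * x ^ j) * x ^ n := by
      rw [hsum]
      noncomm_ring
    rw [h1]
    exact sub_mem (Ideal.pow_le_pow_right (Nat.le_add_left _ _) (hC _ (Y l)))
      (mul_mem_jacobson_pow_right _ (hs l))
  refine ⟨e i * s * e i, S.mul_mul_mem_corner _ _ _, ?_⟩
  have h2 : e i * x ^ n = x ^ n * e i ∨ n = 0 := by
    rcases n with _ | n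
    · exact Or.inr rfl
    · left
      rw [pow_succ, mul_assoc, hx.2, ← pow_succ, pow_succ', ← mul_assoc, hx.1]
  rcases h2 with h2 | rfl
  · rw [mul_assoc, h2, ← mul_assoc, mul_assoc (e i), ← hy', hy.1, hy.2]
  · rw [pow_zero, mul_one] at hy' ⊢
    rw [← hy', hy.1, hy.2]

variable (k e) in
omit S [Fintype ι] in
/-- A uniformizing element of a local corner. -/
structure _root_.IsUniformizer (i : ι) (x : A) : Prop where
  mem : x ∈ corner k e i i
  mem_jacobson : x ∈ 𝔯
  ne_zero : x ≠ 0
  exists_eq : ∀ y ∈ corner k e i i, y ≠ 0 →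
    ∃ (n : ℕ) (u : A), u ∈ corner k e i i ∧ u ∉ 𝔯 ∧ y = u * x ^ n

/-- Radical elements of the corner are approximate multiples of x by `exists_le_span_powers`, hence
exact ones by `exists_eq_mul_pow`. A nonzero y is not divisible by all powers of x, as these tend to
zero; once no further x splits off, the cofactor is a unit. -/
theorem exists_isUniformizer [Infinite k] (i : ι) : ∃ x, IsUniformizer k e i x := by
  obtain ⟨x, hx, hxl⟩ := S.exists_le_span_powers i
  have hx0 : x ≠ 0 := by
    rintro rfl
    obtain ⟨a, ha, ha0⟩ := S.exists_mem_cornerRadical_ne_zero i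
    refine ha0 (S.admissible.eq_zero fun l => ?_)
    have := hxl l ha
    have h0 : Submodule.span k (Set.range fun m : ℕ => (0 : A) ^ (m + 1)) = ⊥ := by
      rw [Submodule.span_eq_bot]
      rintro _ ⟨m, rfl⟩
      simp
    rwa [h0, bot_sup_eq] at this
  have hdiv : ∀ y ∈ corner k e i i, y ∈ 𝔯 → ∃ a ∈ corner k e i i, y = a * x := by
    intro y hy hyr
    have := S.exists_eq_mul_pow hx.1 hx.2 hx0 (n := 1) hy ?_
    · simpa using this
    · intro l
      obtain ⟨t, ht, r, hr, rfl⟩ := Submodule.mem_sup.1 (hxl l ⟨hy, hyr⟩)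
      have h1 : ∀ t ∈ Submodule.span k (Set.range fun m : ℕ => x ^ (m + 1)),
          ∃ a ∈ corner k e i i, t = a * x ^ 1 := by
        intro t ht
        induction ht using Submodule.span_induction with
        | mem t ht =>
          obtain ⟨m, rfl⟩ := ht
          refine ⟨_, (S.corner_pow_ne_zero hx.1 hx0 m).1, ?_⟩
          dsimp only
          rw [mul_assoc, ← pow_add, pow_succ', ← mul_assoc, hx.1.1]
        | zero => exact ⟨0, zero_mem _, by simp⟩
        | add s t _ _ h1 h2 =>
          obtain ⟨a, ha, rfl⟩ := h1
          obtain ⟨b, hb, rfl⟩ := h2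
          exact ⟨a + b, add_mem ha hb, (add_mul _ _ _).symm⟩
        | smul c t _ h1 =>
          obtain ⟨a, ha, rfl⟩ := h1
          exact ⟨c • a, Submodule.smul_mem _ _ ha, (smul_mul_assoc _ _ _).symm⟩
      obtain ⟨a, ha, rfl⟩ := h1 t ht
      exact ⟨a, ha, by simpa [mem_radicalPow] using hr⟩
  refine ⟨x, hx.1, hx.2, hx0, fun y hy hy0 => ?_⟩
  have hex : ∃ n, ¬ ∃ a ∈ corner k e i i, y = a * x ^ n := by
    by_contra! hcon
    refine hy0 (S.admissible.eq_zero fun l => ?_)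
    obtain ⟨a, -, rfl⟩ := hcon l
    exact mul_mem_jacobson_pow_left _ (pow_mem_jacobson_pow hx.2 l)
  classical
  have hspec := Nat.find_spec hex
  have hmin := fun m => Nat.find_min hex (m := m)
  rcases hn : Nat.find hex with _ | n
  · rw [hn] at hspec
    exact (hspec ⟨y, hy, by simp⟩).elim
  · rw [hn] at hspec hmin
    obtain ⟨a, ha, hya⟩ := not_not.1 (hmin n (Nat.lt_succ_self n))
    refine ⟨n, a, ha, fun har => hspec ?_, hya⟩
    obtain ⟨b, hb, rfl⟩ := hdiv a ha har
    exact ⟨b, hb, by rw [hya, pow_succ', mul_assoc]⟩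

end IsMildSystem

end Uniformizer

/-! ### Generators of the Peirce components -/

section RadicalGenerator

variable {k : Type u} {A : Type v} [Field k] [Ring A] [Algebra k A] {ι : Type w} {e : ι → A}

local notation "𝔯" => Ring.jacobson A

variable (k e) in
/-- A generator, from both sides, of the radical part of a Peirce component. -/
structure IsRadicalGenerator (i j : ι) (g : A) : Prop where
  mem : g ∈ corner k e i j
  mem_jacobson : g ∈ 𝔯
  ne_zero : g ≠ 0
  left : ∀ a ∈ corner k e i j, a ∈ 𝔯 → ∃ s ∈ corner k e i i, a = s * g
  right : ∀ a ∈ corner k e i j, a ∈ 𝔯 → ∃ t ∈ corner k e j j, a = g * t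

namespace IsMildSystem

variable [Fintype ι] (S : IsMildSystem k e) [Infinite k]

include S

/-- If ac = 0, then csa squares to zero for every s; primeness provides s with csa ≠ 0,
contradicting that the corner at j is a domain. -/
theorem corner_mul_ne_zero {i j l : ι} {a c : A} (ha : a ∈ corner k e i j)
    (hc : c ∈ corner k e j l) (ha0 : a ≠ 0) (hc0 : c ≠ 0) : a * c ≠ 0 := by
  obtain ⟨s, hs, hs0⟩ := S.exists_mul_corner_mul_ne_zero hc ha hc0 ha0
  intro h0
  have h1 : (c * s) * a * ((c * s) * a) = 0 := by
    have : (c * s) * a * ((c * s) * a) = c * s * ((a * c) * s * a) := by noncomm_ring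
    rw [this, h0]
    simp
  have hmem := mul_mem_corner (mul_mem_corner hc hs) ha
  exact S.local_mul_ne_zero hmem hmem hs0 hs0 h1

theorem corner_mul_left_cancel {i j l : ι} {a c d : A} (ha : a ∈ corner k e i j) (ha0 : a ≠ 0)
    (hc : c ∈ corner k e j l) (hd : d ∈ corner k e j l) (h : a * c = a * d) : c = d := by
  by_contra hcd
  refine S.corner_mul_ne_zero ha (sub_mem hc hd) ha0 (sub_ne_zero.2 hcd) ?_
  rw [mul_sub, h, sub_self]

theorem corner_mul_right_cancel {i j l : ι} {a c d : A} (ha : a ∈ corner k e j l) (ha0 : a ≠ 0)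
    (hc : c ∈ corner k e i j) (hd : d ∈ corner k e i j) (h : c * a = d * a) : c = d := by
  by_contra hcd
  refine S.corner_mul_ne_zero (sub_mem hc hd) ha (sub_ne_zero.2 hcd) ha0 ?_
  rw [sub_mul, h, sub_self]

theorem notMem_of_mul_eq {i j : ι} {b s : A} (hb : b ∈ corner k e i j) (hb0 : b ≠ 0)
    (hs : s ∈ corner k e i i) (h : s * b = b) : s ∉ 𝔯 := by
  have : s = e i := S.corner_mul_right_cancel hb hb0 hs (S.self_mem_corner i) (by rw [h, hb.1])
  rw [this]
  exact S.notMem i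

theorem notMem_of_mul_eq_right {i j : ι} {b t : A} (hb : b ∈ corner k e i j) (hb0 : b ≠ 0)
    (ht : t ∈ corner k e j j) (h : b * t = b) : t ∉ 𝔯 := by
  have : t = e j := S.corner_mul_left_cancel hb hb0 ht (S.self_mem_corner j) (by rw [h, hb.2])
  rw [this]
  exact S.notMem j

/-- Right multiplication by a nonzero d in e_j A e_i embeds the component into the valuation ring
e_i A e_i; b is an element whose image has least valuation. -/
theorem exists_left_generator (i j : ι) : ∃ b ∈ corner k e i j, b ≠ 0 ∧
    ∀ a ∈ corner k e i j, ∃ s ∈ corner k e i i, a = s * b := by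
  classical
  obtain ⟨x, hx⟩ := S.exists_isUniformizer i
  obtain ⟨d, hd, hd0⟩ := S.exists_corner_ne_zero j i
  obtain ⟨c, hc, hc0⟩ := S.exists_corner_ne_zero i j
  have hval : ∀ a ∈ corner k e i j, a ≠ 0 → ∃ (n : ℕ) (u : A), u ∈ corner k e i i ∧ u ∉ 𝔯 ∧
      a * d = u * x ^ n := fun a ha ha0 =>
    hx.exists_eq _ (mul_mem_corner ha hd) (S.corner_mul_ne_zero ha hd ha0 hd0)
  have hex : ∃ n : ℕ, ∃ b ∈ corner k e i j, b ≠ 0 ∧ ∃ u ∈ corner k e i i, u ∉ 𝔯 ∧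
      b * d = u * x ^ n := by
    obtain ⟨n, u, hu, hur, hcd⟩ := hval c hc hc0
    exact ⟨n, c, hc, hc0, u, hu, hur, hcd⟩
  have hmin := fun m => Nat.find_min hex (m := m)
  obtain ⟨b, hb, hb0, u, hu, hur, hbd⟩ := Nat.find_spec hex
  refine ⟨b, hb, hb0, fun a ha => ?_⟩
  rcases eq_or_ne a 0 with rfl | ha0
  · exact ⟨0, zero_mem _, by simp⟩
  obtain ⟨n, w, hw, hwr, had⟩ := hval a ha ha0
  have hn : Nat.find hex ≤ n := by
    by_contra! hlt
    exact hmin n hlt ⟨a, ha, ha0, w, hw, hwr, had⟩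
  obtain ⟨m, rfl⟩ := Nat.exists_eq_add_of_le' hn
  obtain ⟨v, hv, -, huv, hvu⟩ := S.exists_inverse hu hur
  have hs : w * x ^ m * v ∈ corner k e i i :=
    mul_mem_corner (S.mul_corner_pow_mem hx.mem hx.ne_zero hw m) hv
  refine ⟨_, hs, S.corner_mul_right_cancel hd hd0 ha (mul_mem_corner hs hb) ?_⟩
  have h1 : w * x ^ m * e i = w * x ^ m :=
    (S.mul_corner_pow_mem hx.mem hx.ne_zero hw m).2
  rw [mul_assoc _ b, hbd, had, mul_assoc _ v, ← mul_assoc v u, hvu, ← mul_assoc, h1, mul_assoc,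
    pow_add]

theorem exists_right_generator (i j : ι) : ∃ b ∈ corner k e i j, b ≠ 0 ∧
    ∀ a ∈ corner k e i j, ∃ t ∈ corner k e j j, a = b * t := by
  classical
  obtain ⟨x, hx⟩ := S.exists_isUniformizer j
  obtain ⟨d, hd, hd0⟩ := S.exists_corner_ne_zero j i
  obtain ⟨c, hc, hc0⟩ := S.exists_corner_ne_zero i j
  have hval : ∀ a ∈ corner k e i j, a ≠ 0 → ∃ (n : ℕ) (u : A), u ∈ corner k e j j ∧ u ∉ 𝔯 ∧
      d * a = u * x ^ n := fun a ha ha0 =>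
    hx.exists_eq _ (mul_mem_corner hd ha) (S.corner_mul_ne_zero hd ha hd0 ha0)
  have hex : ∃ n : ℕ, ∃ b ∈ corner k e i j, b ≠ 0 ∧ ∃ u ∈ corner k e j j, u ∉ 𝔯 ∧
      d * b = u * x ^ n := by
    obtain ⟨n, u, hu, hur, hcd⟩ := hval c hc hc0
    exact ⟨n, c, hc, hc0, u, hu, hur, hcd⟩
  have hmin := fun m => Nat.find_min hex (m := m)
  obtain ⟨b, hb, hb0, u, hu, hur, hbd⟩ := Nat.find_spec hex
  refine ⟨b, hb, hb0, fun a ha => ?_⟩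
  rcases eq_or_ne a 0 with rfl | ha0
  · exact ⟨0, zero_mem _, by simp⟩
  obtain ⟨n, w, hw, hwr, had⟩ := hval a ha ha0
  have hn : Nat.find hex ≤ n := by
    by_contra! hlt
    exact hmin n hlt ⟨a, ha, ha0, w, hw, hwr, had⟩
  obtain ⟨m, rfl⟩ := Nat.exists_eq_add_of_le' hn
  obtain ⟨v, hv, -, huv, hvu⟩ := S.exists_inverse hu hur
  have hs : w * x ^ m * v ∈ corner k e j j :=
    mul_mem_corner (S.mul_corner_pow_mem hx.mem hx.ne_zero hw m) hv
  refine ⟨_, hs, S.corner_mul_left_cancel hd hd0 ha (mul_mem_corner hb hs) ?_⟩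
  have h1 : w * x ^ m * e j = w * x ^ m :=
    (S.mul_corner_pow_mem hx.mem hx.ne_zero hw m).2
  rw [← mul_assoc d, hbd, S.corner_mul_comm (S.mul_corner_pow_mem hx.mem hx.ne_zero hu _) hs,
    had, mul_assoc _ v, ← mul_assoc v u, hvu, ← mul_assoc, h1, mul_assoc, pow_add]

/-- On the diagonal this is a uniformizer. Off the diagonal the whole component is radical, with a
left generator b and a right generator b' = y b. Writing b = b' t = y b t and b t = s b gives y s =
e_i, so y is a unit and b generates from the right as well. -/
theorem exists_isRadicalGenerator (i j : ι) : ∃ g, IsRadicalGenerator k e i j g := by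
  rcases eq_or_ne i j with rfl | hij
  · obtain ⟨x, hx⟩ := S.exists_isUniformizer i
    have hleft : ∀ a ∈ corner k e i i, a ∈ 𝔯 → ∃ s ∈ corner k e i i, a = s * x := by
      intro a ha har
      rcases eq_or_ne a 0 with rfl | ha0
      · exact ⟨0, zero_mem _, by simp⟩
      obtain ⟨n, u, hu, hur, rfl⟩ := hx.exists_eq a ha ha0
      rcases n with _ | n
      · simp [hur] at har
      · exact ⟨u * x ^ n, S.mul_corner_pow_mem hx.mem hx.ne_zero hu n, by rw [pow_succ, mul_assoc]⟩
    refine ⟨x, hx.mem, hx.mem_jacobson, hx.ne_zero, hleft, fun a ha har => ?_⟩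
    obtain ⟨s, hs, rfl⟩ := hleft a ha har
    exact ⟨s, hs, S.corner_mul_comm hs hx.mem⟩
  · obtain ⟨b, hb, hb0, hleft⟩ := S.exists_left_generator i j
    obtain ⟨b', hb', hb0', hright⟩ := S.exists_right_generator i j
    obtain ⟨y, hy, hyb⟩ := hleft b' hb'
    obtain ⟨t, ht, hbt⟩ := hright b hb
    obtain ⟨s, hs, hbs⟩ := hleft (b * t) (mul_mem_corner hb ht)
    have hys : y * s = e i := by
      refine S.corner_mul_right_cancel hb hb0 (mul_mem_corner hy hs) (S.self_mem_corner i) ?_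
      rw [mul_assoc, ← hbs, ← mul_assoc, ← hyb, ← hbt, hb.1]
    refine ⟨b, hb, S.mem_jacobson_of_mem_corner hij hb, hb0, fun a ha _ => hleft a ha,
      fun a ha _ => ?_⟩
    obtain ⟨r, hr, hya⟩ := hright (y * a) (mul_mem_corner hy ha)
    refine ⟨r, hr, ?_⟩
    have h1 : s * (y * a) = s * (b' * r) := by rw [hya]
    rw [← mul_assoc, S.corner_mul_comm hs hy, hys, ha.1, hyb, ← mul_assoc, ← mul_assoc,
      S.corner_mul_comm hs hy, hys, hb.1] at h1
    exact h1

end IsMildSystem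

namespace IsRadicalGenerator

variable {i j : ι} {g : A} (hg : IsRadicalGenerator k e i j g)

include hg

/-- Two-sided generation lets coefficients be moved across g, exchanging the corners at i and j. -/
theorem exists_mul_eq_right {s : A} (hs : s ∈ corner k e i i) :
    ∃ t ∈ corner k e j j, s * g = g * t :=
  hg.right _ (mul_mem_corner hs hg.mem) (Ideal.mul_mem_left _ _ hg.mem_jacobson)

theorem exists_mul_eq_left {t : A} (ht : t ∈ corner k e j j) :
    ∃ s ∈ corner k e i i, g * t = s * g :=
  hg.left _ (mul_mem_corner hg.mem ht) (Ideal.mul_mem_right _ _ hg.mem_jacobson)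

variable [Fintype ι] (S : IsMildSystem k e) [Infinite k]

include S

/-- Otherwise s has an inverse v; moving v across g as r gives g = g(r t) with r t radical, so g
could not be cancelled. Thus the exchange of coefficients respects the radicals. -/
theorem mem_jacobson_left {s t : A} (hs : s ∈ corner k e i i) (ht : t ∈ corner k e j j)
    (htr : t ∈ 𝔯) (h : g * t = s * g) : s ∈ 𝔯 := by
  by_contra hsr
  obtain ⟨v, hv, -, -, hvs⟩ := S.exists_inverse hs hsr
  obtain ⟨r, hr, hvr⟩ := hg.exists_mul_eq_right hv
  have h1 : g * (r * t) = g := by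
    rw [← mul_assoc, ← hvr, mul_assoc, h, ← mul_assoc, hvs, hg.mem.1]
  exact S.notMem_of_mul_eq_right hg.mem hg.ne_zero (mul_mem_corner hr ht) h1
    (Ideal.mul_mem_left _ _ htr)

theorem mem_jacobson_right {s t : A} (hs : s ∈ corner k e i i) (ht : t ∈ corner k e j j)
    (hsr : s ∈ 𝔯) (h : g * t = s * g) : t ∈ 𝔯 := by
  by_contra htr
  obtain ⟨v, hv, -, htv, -⟩ := S.exists_inverse ht htr
  obtain ⟨r, hr, hvr⟩ := hg.exists_mul_eq_left hv
  have h1 : (s * r) * g = g := by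
    rw [mul_assoc, ← hvr, ← mul_assoc, ← h, mul_assoc, htv, hg.mem.2]
  exact S.notMem_of_mul_eq hg.mem hg.ne_zero (mul_mem_corner hs hr) h1
    (Ideal.mul_mem_right _ _ hsr)

end IsRadicalGenerator

end RadicalGenerator

/-! ### A one-parameter family of modules with two generators -/

section TwoVertices

variable {k : Type u} {A : Type v} [Field k] [Ring A] [Algebra k A] {ι : Type w} {e : ι → A}

local notation "𝔯" => Ring.jacobson A

/-- The relations of a module with two generators `(e p, 0)` and `(0, e q)`, related by
`x (e p, 0) = b (0, e q)` and `b' (e p, 0) = t y (0, e q)`, modulo a left ideal `N`. -/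
def twoVertexRelations (e : ι → A) (p q : ι) (N : Ideal A) (x b b' y : A) (t : k) :
    Submodule A (A × A) :=
  Submodule.span A {(1 - e p, 0), (0, 1 - e q), (x, -b), (b', -(t • y))} ⊔ Submodule.prod N N

theorem prod_le_twoVertexRelations {p q : ι} {N : Ideal A} {x b b' y : A} {t : k} :
    Submodule.prod N N ≤ twoVertexRelations e p q N x b b' y t := le_sup_right

theorem Submodule.mem_span_quadruple {M : Type w} [AddCommGroup M] [Module A M] {a b c d z : M} :
    z ∈ Submodule.span A {a, b, c, d} ↔
      ∃ r s t u : A, r • a + s • b + t • c + u • d = z := by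
  simp only [Submodule.mem_span_insert, Submodule.mem_span_singleton]
  constructor
  · rintro ⟨r, _, ⟨s, _, ⟨t, _, ⟨u, rfl⟩, rfl⟩, rfl⟩, rfl⟩
    exact ⟨r, s, t, u, by abel⟩
  · rintro ⟨r, s, t, u, rfl⟩
    exact ⟨r, _, ⟨s, _, ⟨t, _, ⟨u, rfl⟩, rfl⟩, rfl⟩, by abel⟩

namespace IsMildSystem

variable [Fintype ι] (S : IsMildSystem k e)

/-- Left ideals containing the square of the radical at two vertices, and elements outside such an
ideal for each ordered pair of these vertices. -/
structure TwoVertexData (e : ι → A) (p q : ι) (N : Ideal A) (x b b' y : A) : Prop where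
  ne : p ≠ q
  mul_left_mem : ∀ n ∈ N, n * e p ∈ N
  mul_right_mem : ∀ n ∈ N, n * e q ∈ N
  mul_mem : ∀ i j l, (i = p ∨ i = q) → (j = p ∨ j = q) → (l = p ∨ l = q) →
    ∀ s ∈ corner k e i j, s ∈ 𝔯 → ∀ t ∈ corner k e j l, t ∈ 𝔯 → s * t ∈ N
  mem_x : x ∈ corner k e p p
  mem_b : b ∈ corner k e p q
  mem_b' : b' ∈ corner k e q p
  mem_y : y ∈ corner k e q q
  jac_x : x ∈ 𝔯
  jac_y : y ∈ 𝔯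
  notMem_x : x ∉ N
  notMem_b : b ∉ N
  notMem_b' : b' ∉ N
  notMem_y : y ∉ N

variable {p q : ι} {N : Ideal A} {x b b' y : A}

theorem _root_.eq_of_sub_smul_mem {c d : k} (hx : x ∉ N) (h : c • x - d • x ∈ N) : c = d := by
  by_contra hcd
  rw [← sub_smul] at h
  have := N.smul_mem_of_algebra (c - d)⁻¹ h
  rw [smul_smul, inv_mul_cancel₀ (sub_ne_zero.2 hcd), one_smul] at this
  exact hx this

variable (D : TwoVertexData (k := k) e p q N x b b' y)

include S D

/-- Modulo N only the scalar parts c and d of the coefficients of the last two relations survive,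
everything else being a product of two radical elements. That x and b share c, while b' and t y
share d, is the rigidity behind the family. -/
theorem TwoVertexData.exists_of_mem {t : k} {u v : A}
    (h : (u, v) ∈ twoVertexRelations e p q N x b b' y t) :
    ∃ c d : k, e p * u * e p - c • x ∈ N ∧ e p * v * e q + c • b ∈ N ∧
      e q * u * e p - d • b' ∈ N ∧ e q * v * e q + d • t • y ∈ N := by
  obtain ⟨z, hz, ⟨n₁, n₂⟩, hn, hzn⟩ := Submodule.mem_sup.1 h
  obtain ⟨f, g, s, r, rfl⟩ := Submodule.mem_span_quadruple.1 hz
  obtain ⟨hn₁, hn₂⟩ := hn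
  have hbr : b ∈ 𝔯 := S.mem_jacobson_of_mem_corner D.ne D.mem_b
  have hb'r : b' ∈ 𝔯 := S.mem_jacobson_of_mem_corner D.ne.symm D.mem_b'
  have htyr : t • y ∈ 𝔯 := Ideal.smul_mem_of_algebra _ _ D.jac_y
  have hty : t • y ∈ corner k e q q := Submodule.smul_mem _ _ D.mem_y
  simp only [Prod.smul_mk, Prod.mk_add_mk, Prod.mk.injEq, smul_eq_mul, mul_zero, add_zero,
    zero_add] at hzn
  obtain ⟨rfl, rfl⟩ := hzn
  have hu : (f * (1 - e p) + s * x + r * b' + n₁) * e p = s * x + r * b' + n₁ * e p := by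
    rw [add_mul, add_mul, add_mul, mul_assoc f, sub_mul, S.idem, one_mul, sub_self, mul_zero,
      zero_add, mul_assoc s, mul_assoc r, D.mem_x.2, D.mem_b'.2]
  have hv : (g * (1 - e q) + s * (-b) + r * (-(t • y)) + n₂) * e q =
      -(s * b) - r * (t • y) + n₂ * e q := by
    rw [add_mul, add_mul, add_mul, mul_assoc g, sub_mul, S.idem, one_mul, sub_self, mul_zero,
      zero_add, mul_assoc s, mul_assoc r, neg_mul, neg_mul, D.mem_b.2, hty.2]
    noncomm_ring
  obtain ⟨c, s', hs', hsr', hs⟩ := S.exists_eq_smul_add (S.mul_mul_mem_corner p p s)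
  obtain ⟨d, r', hr', hrr', hr⟩ := S.exists_eq_smul_add (S.mul_mul_mem_corner q q r)
  have hpr := S.mul_mul_mem_corner p q r
  have hprr := S.mem_jacobson_of_mem_corner D.ne hpr
  have hqs := S.mul_mul_mem_corner q p s
  have hqsr := S.mem_jacobson_of_mem_corner D.ne.symm hqs
  have hn₁' := D.mul_left_mem _ hn₁
  have hn₂' := D.mul_right_mem _ hn₂
  refine ⟨c, d, ?_, ?_, ?_, ?_⟩
  · have : e p * (f * (1 - e p) + s * x + r * b' + n₁) * e p - c • x =
        s' * x + e p * r * e q * b' + e p * (n₁ * e p) := by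
      rw [mul_assoc (e p) _ (e p), hu, mul_add, mul_add]
      have h1 : e p * (s * x) = c • x + s' * x := by
        rw [← D.mem_x.1, ← mul_assoc s, ← mul_assoc, ← mul_assoc, hs, add_mul, smul_mul_assoc,
          D.mem_x.1]
      have h2 : e p * (r * b') = e p * r * e q * b' := by
        rw [mul_assoc (e p * r), D.mem_b'.1, mul_assoc]
      rw [h1, h2]
      abel
    rw [this]
    exact add_mem (add_mem
      (D.mul_mem p p p (.inl rfl) (.inl rfl) (.inl rfl) _ hs' hsr' _ D.mem_x D.jac_x)
      (D.mul_mem p q p (.inl rfl) (.inr rfl) (.inl rfl) _ hpr hprr _ D.mem_b' hb'r))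
      (N.mul_mem_left _ hn₁')
  · have : e p * (g * (1 - e q) + s * (-b) + r * (-(t • y)) + n₂) * e q + c • b =
        -(s' * b) - e p * r * e q * (t • y) + e p * (n₂ * e q) := by
      rw [mul_assoc (e p) _ (e q), hv, mul_add, mul_sub, mul_neg]
      have h1 : e p * (s * b) = c • b + s' * b := by
        rw [← D.mem_b.1, ← mul_assoc s, ← mul_assoc, ← mul_assoc, hs, add_mul, smul_mul_assoc,
          D.mem_b.1]
      have h2 : e p * (r * (t • y)) = e p * r * e q * (t • y) := by
        rw [mul_assoc (e p * r), hty.1, mul_assoc]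
      rw [h1, h2]
      abel
    rw [this]
    exact add_mem (sub_mem
      (neg_mem (D.mul_mem p p q (.inl rfl) (.inl rfl) (.inr rfl) _ hs' hsr' _ D.mem_b hbr))
      (D.mul_mem p q q (.inl rfl) (.inr rfl) (.inr rfl) _ hpr hprr _ hty htyr))
      (N.mul_mem_left _ hn₂')
  · have : e q * (f * (1 - e p) + s * x + r * b' + n₁) * e p - d • b' =
        e q * s * e p * x + r' * b' + e q * (n₁ * e p) := by
      rw [mul_assoc (e q) _ (e p), hu, mul_add, mul_add]
      have h1 : e q * (r * b') = d • b' + r' * b' := by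
        rw [← D.mem_b'.1, ← mul_assoc r, ← mul_assoc, ← mul_assoc, hr, add_mul, smul_mul_assoc,
          D.mem_b'.1]
      have h2 : e q * (s * x) = e q * s * e p * x := by
        rw [mul_assoc (e q * s), D.mem_x.1, mul_assoc]
      rw [h1, h2]
      abel
    rw [this]
    exact add_mem (add_mem
      (D.mul_mem q p p (.inr rfl) (.inl rfl) (.inl rfl) _ hqs hqsr _ D.mem_x D.jac_x)
      (D.mul_mem q q p (.inr rfl) (.inr rfl) (.inl rfl) _ hr' hrr' _ D.mem_b' hb'r))
      (N.mul_mem_left _ hn₁')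
  · have : e q * (g * (1 - e q) + s * (-b) + r * (-(t • y)) + n₂) * e q + d • t • y =
        -(e q * s * e p * b) - r' * (t • y) + e q * (n₂ * e q) := by
      rw [mul_assoc (e q) _ (e q), hv, mul_add, mul_sub, mul_neg]
      have h1 : e q * (r * (t • y)) = d • t • y + r' * (t • y) := by
        rw [← hty.1, ← mul_assoc r, ← mul_assoc, ← mul_assoc, hr, add_mul, smul_mul_assoc,
          hty.1]
      have h2 : e q * (s * b) = e q * s * e p * b := by
        rw [mul_assoc (e q * s), D.mem_b.1, mul_assoc]
      rw [h1, h2]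
      abel
    rw [this]
    exact add_mem (sub_mem
      (neg_mem (D.mul_mem q p q (.inr rfl) (.inl rfl) (.inr rfl) _ hqs hqsr _ D.mem_b hbr))
      (D.mul_mem q q q (.inr rfl) (.inr rfl) (.inr rfl) _ hr' hrr' _ hty htyr))
      (N.mul_mem_left _ hn₂')

/-- A homomorphism between two modules of the family is a scalar modulo the radical. -/
theorem TwoVertexData.exists_of_hom {t t' : k}
    (F : ((A × A) ⧸ twoVertexRelations e p q N x b b' y t) →ₗ[A]
      ((A × A) ⧸ twoVertexRelations e p q N x b b' y t')) :
    ∃ (c : k) (α β γ δ : A), c * t' = t * c ∧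
      (α ∈ corner k e p p ∧ α ∈ 𝔯) ∧ (β ∈ corner k e p q ∧ β ∈ 𝔯) ∧
      (γ ∈ corner k e q p ∧ γ ∈ 𝔯) ∧ (δ ∈ corner k e q q ∧ δ ∈ 𝔯) ∧
      F (Submodule.mkQ _ (1, 0)) = Submodule.mkQ _ (c • e p + α, β) ∧
      F (Submodule.mkQ _ (0, 1)) = Submodule.mkQ _ (γ, c • e q + δ) := by
  let W := twoVertexRelations e p q N x b b' y t
  let W' := twoVertexRelations e p q N x b b' y t'
  have hspan : ∀ {t : k} {z : A × A},
      z ∈ ({(1 - e p, 0), (0, 1 - e q), (x, -b), (b', -(t • y))} : Set (A × A)) →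
      z ∈ twoVertexRelations e p q N x b b' y t := fun hz =>
    Submodule.mem_sup_left (Submodule.subset_span hz)
  have hleft : ∀ (t : k) (f : A), (f - f * e p, 0) ∈ twoVertexRelations e p q N x b b' y t := by
    intro t f
    have := Submodule.smul_mem _ f (hspan (t := t) (z := (1 - e p, 0)) (by simp))
    simpa [mul_sub] using this
  have hright : ∀ (t : k) (f : A), (0, f - f * e q) ∈ twoVertexRelations e p q N x b b' y t := by
    intro t f
    have := Submodule.smul_mem _ f (hspan (t := t) (z := (0, 1 - e q)) (by simp))
    simpa [mul_sub] using this
  have hcut : ∀ f g h : A, h • Submodule.mkQ W' (f, g) =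
      Submodule.mkQ W' (h * f * e p, h * g * e q) := by
    intro f g h
    rw [← map_smul]
    refine (Submodule.Quotient.eq W').2 ?_
    convert add_mem (hleft t' (h * f)) (hright t' (h * g)) using 1
    simp
  obtain ⟨⟨a₁, a₂⟩, ha⟩ := Submodule.mkQ_surjective W' (F (Submodule.mkQ W (1, 0)))
  obtain ⟨b₁, b₂⟩ := Submodule.mkQ_surjective W' (F (Submodule.mkQ W (0, 1)))
  obtain ⟨b₁, b₂', hb⟩ : ∃ b₁ b₂, Submodule.mkQ W' (b₁, b₂) = F (Submodule.mkQ W (0, 1)) :=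
    ⟨b₁.1, b₁.2, b₂⟩
  have h1 : F (Submodule.mkQ W (1, 0)) = Submodule.mkQ W' (e p * a₁ * e p, e p * a₂ * e q) := by
    have : Submodule.mkQ W (1, 0) = e p • Submodule.mkQ W (1, 0) := by
      rw [← map_smul]
      refine (Submodule.Quotient.eq W).2 ?_
      simpa using hleft t 1
    rw [this, map_smul, ← ha, hcut]
  have h2 : F (Submodule.mkQ W (0, 1)) = Submodule.mkQ W' (e q * b₁ * e p, e q * b₂' * e q) := by
    have : Submodule.mkQ W (0, 1) = e q • Submodule.mkQ W (0, 1) := by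
      rw [← map_smul]
      refine (Submodule.Quotient.eq W).2 ?_
      simpa using hright t 1
    rw [this, map_smul, ← hb, hcut]
  obtain ⟨c, α, hα, hαr, hα'⟩ := S.exists_eq_smul_add (S.mul_mul_mem_corner p p a₁)
  obtain ⟨d, δ, hδ, hδr, hδ'⟩ := S.exists_eq_smul_add (S.mul_mul_mem_corner q q b₂')
  have hβ := S.mul_mul_mem_corner p q a₂
  have hβr := S.mem_jacobson_of_mem_corner D.ne hβ
  have hγ := S.mul_mul_mem_corner q p b₁
  have hγr := S.mem_jacobson_of_mem_corner D.ne.symm hγ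
  set β := e p * a₂ * e q with hβ'
  set γ := e q * b₁ * e p with hγ'
  rw [hα'] at h1
  rw [hδ'] at h2
  have hbr : b ∈ 𝔯 := S.mem_jacobson_of_mem_corner D.ne D.mem_b
  have hb'r : b' ∈ 𝔯 := S.mem_jacobson_of_mem_corner D.ne.symm D.mem_b'
  have htyr : t • y ∈ 𝔯 := Ideal.smul_mem_of_algebra _ _ D.jac_y
  have hty : t • y ∈ corner k e q q := Submodule.smul_mem _ _ D.mem_y
  have hrel : ∀ f g : A, (f, g) ∈ W →
      (f * (c • e p + α) + g * γ, f * β + g * (d • e q + δ)) ∈ W' := by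
    intro f g hfg
    have h3 : F (Submodule.mkQ W (f, g)) = 0 := by
      have : Submodule.mkQ W (f, g) = 0 := (Submodule.Quotient.mk_eq_zero W).2 hfg
      rw [this, map_zero]
    have h4 : Submodule.mkQ W (f, g) = f • Submodule.mkQ W (1, 0) + g • Submodule.mkQ W (0, 1) := by
      rw [← map_smul, ← map_smul, ← map_add]
      simp
    rw [h4, map_add, map_smul, map_smul, h1, h2, ← map_smul, ← map_smul, ← map_add] at h3
    exact (Submodule.Quotient.mk_eq_zero W').1 h3
  have hx := hrel x (-b) (hspan (by simp))
  have hb'' := hrel b' (-(t • y)) (hspan (by simp))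
  obtain ⟨c₁, -, h3, h4, -, -⟩ := D.exists_of_mem S hx
  obtain ⟨-, d₁, -, -, h5, h6⟩ := D.exists_of_mem S hb''
  have hcut' : ∀ {i j : ι} {z : A}, z ∈ corner k e i j → e i * z * e j = z := fun hz => by
    rw [hz.1, hz.2]
  -- The images of the two relations are compared in the four Peirce components: the scalars agree
  -- around the four-cycle, and the last comparison brings in t and t'.
  have e1 : c = c₁ := by
    refine eq_of_sub_smul_mem D.notMem_x ?_
    have h7 : e p * (x * (c • e p + α) + -b * γ) * e p = c • x + x * α - b * γ := by
      rw [hcut' (add_mem (mul_mem_corner D.mem_x (hα' ▸ S.mul_mul_mem_corner p p a₁))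
        (mul_mem_corner (neg_mem D.mem_b) hγ)), mul_add, mul_smul_comm, D.mem_x.2, neg_mul]
      abel
    rw [h7] at h3
    have := sub_mem (add_mem h3
      (D.mul_mem p q p (.inl rfl) (.inr rfl) (.inl rfl) _ D.mem_b hbr _ hγ hγr))
      (D.mul_mem p p p (.inl rfl) (.inl rfl) (.inl rfl) _ D.mem_x D.jac_x _ hα hαr)
    convert this using 1
    abel
  have e2 : c₁ = d := by
    refine eq_of_sub_smul_mem D.notMem_b ?_
    have h7 : e p * (x * β + -b * (d • e q + δ)) * e q = x * β - d • b - b * δ := by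
      rw [hcut' (add_mem (mul_mem_corner D.mem_x hβ)
        (mul_mem_corner (neg_mem D.mem_b) (hδ' ▸ S.mul_mul_mem_corner q q b₂'))), neg_mul, mul_add,
        mul_smul_comm, D.mem_b.2]
      abel
    rw [h7] at h4
    have := sub_mem (add_mem h4
      (D.mul_mem p q q (.inl rfl) (.inr rfl) (.inr rfl) _ D.mem_b hbr _ hδ hδr))
      (D.mul_mem p p q (.inl rfl) (.inl rfl) (.inr rfl) _ D.mem_x D.jac_x _ hβ hβr)
    convert this using 1
    abel
  have e3 : c = d₁ := by
    refine eq_of_sub_smul_mem D.notMem_b' ?_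
    have h7 : e q * (b' * (c • e p + α) + -(t • y) * γ) * e p =
        c • b' + b' * α - (t • y) * γ := by
      rw [hcut' (add_mem (mul_mem_corner D.mem_b' (hα' ▸ S.mul_mul_mem_corner p p a₁))
        (mul_mem_corner (neg_mem hty) hγ)), mul_add, mul_smul_comm, D.mem_b'.2, neg_mul]
      abel
    rw [h7] at h5
    have := sub_mem (add_mem h5
      (D.mul_mem q q p (.inr rfl) (.inr rfl) (.inl rfl) _ hty htyr _ hγ hγr))
      (D.mul_mem q p p (.inr rfl) (.inl rfl) (.inl rfl) _ D.mem_b' hb'r _ hα hαr)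
    convert this using 1
    abel
  have e4 : d₁ * t' = d * t := by
    refine eq_of_sub_smul_mem D.notMem_y ?_
    have h7 : e q * (b' * β + -(t • y) * (d • e q + δ)) * e q =
        b' * β - d • t • y - (t • y) * δ := by
      rw [hcut' (add_mem (mul_mem_corner D.mem_b' hβ)
        (mul_mem_corner (neg_mem hty) (hδ' ▸ S.mul_mul_mem_corner q q b₂'))), neg_mul, mul_add,
        mul_smul_comm, hty.2]
      abel
    rw [h7] at h6
    have := sub_mem (add_mem h6
      (D.mul_mem q q q (.inr rfl) (.inr rfl) (.inr rfl) _ hty htyr _ hδ hδr))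
      (D.mul_mem q p q (.inr rfl) (.inl rfl) (.inr rfl) _ D.mem_b' hb'r _ hβ hβr)
    convert this using 1
    rw [smul_smul, smul_smul]
    abel
  refine ⟨c, α, β, γ, δ, ?_, ⟨hα, hαr⟩, ⟨hβ, hβr⟩, ⟨hγ, hγr⟩, ⟨hδ, hδr⟩, h1, ?_⟩
  · rw [e3, e4, ← e2, ← e1, e3, mul_comm]
  · rw [e1, e2]
    exact h2

end IsMildSystem

end TwoVertices

/-! ### Indecomposability and pairwise non-isomorphism of the two-generator modules -/

section TwoVertexFamily

variable {k : Type u} {A : Type v} [Field k] [Ring A] [Algebra k A] {ι : Type w} {e : ι → A}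

local notation "𝔯" => Ring.jacobson A

theorem IsAdmissibleAlgebra.finite_quotient_prod (h : IsAdmissibleAlgebra k A) {N : Ideal A} {l : ℕ}
    (hl : 𝔯 ^ l ≤ N) {W : Submodule A (A × A)} (hW : Submodule.prod N N ≤ W) :
    Module.Finite k ((A × A) ⧸ W) := by
  obtain ⟨F, hF, hF'⟩ := h.exists_finite_supplement l
  refine Module.Finite.of_surjective (((Submodule.mkQ W).restrictScalars k).comp
    (LinearMap.prodMap F.subtype F.subtype)) ?_
  intro z
  obtain ⟨⟨a, b⟩, rfl⟩ := Submodule.mkQ_surjective W z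
  obtain ⟨f, hf, hf'⟩ := hF' a
  obtain ⟨g, hg, hg'⟩ := hF' b
  refine ⟨(⟨f, hf⟩, ⟨g, hg⟩), ?_⟩
  exact ((Submodule.Quotient.eq W).2 (hW ⟨hl hf', hl hg'⟩)).symm

namespace IsMildSystem

variable [Fintype ι] (S : IsMildSystem k e) {p q : ι} {N : Ideal A} {x b b' y : A}
  (D : TwoVertexData (k := k) e p q N x b b' y)

include S D

/-- The single scalar c would have to be 1 at x and 0 at b. -/
theorem TwoVertexData.notMem_relations (t : k) :
    (x, (0 : A)) ∉ twoVertexRelations e p q N x b b' y t := by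
  intro h
  obtain ⟨c, -, h1, h2, -, -⟩ := D.exists_of_mem S h
  rw [D.mem_x.1, D.mem_x.2] at h1
  rw [mul_zero, zero_mul] at h2
  have e1 : (1 : k) = c := eq_of_sub_smul_mem D.notMem_x (by rwa [one_smul])
  have e2 : (0 : k) = c := eq_of_sub_smul_mem D.notMem_b (by simpa using h2)
  exact one_ne_zero (e1.trans e2.symm)

/-- An endomorphism minus its scalar is given by a 2 × 2 matrix with radical entries, whose square
has entries in N and so acts as zero. -/
theorem TwoVertexData.isIndecomposable (t : k) :
    IsIndecomposableModule A ((A × A) ⧸ twoVertexRelations e p q N x b b' y t) := by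
  have hnon : Nontrivial ((A × A) ⧸ twoVertexRelations e p q N x b b' y t) := by
    refine Submodule.Quotient.nontrivial_iff.2 fun htop => ?_
    exact D.notMem_relations S t (htop ▸ trivial)
  refine isIndecomposableModule_of_end (k := k) fun f => ?_
  obtain ⟨c, α, β, γ, δ, -, ⟨hα, hαr⟩, ⟨hβ, hβr⟩, ⟨hγ, hγr⟩, ⟨hδ, hδr⟩, h1, h2⟩ :=
    D.exists_of_hom S f
  refine ⟨c, 2, ?_⟩
  let W := twoVertexRelations e p q N x b b' y t
  have hgen : ∀ u v : A, Submodule.mkQ W (u, v) =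
      u • Submodule.mkQ W (1, 0) + v • Submodule.mkQ W (0, 1) := by
    intro u v
    rw [← map_smul, ← map_smul, ← map_add]
    simp
  have hsmul : ∀ z : A × A, c • Submodule.mkQ W z = Submodule.mkQ W (c • z) := fun _ => rfl
  have hp : Submodule.mkQ W (c • e p, 0) = Submodule.mkQ W (c • (1, 0)) := by
    refine ((Submodule.Quotient.eq W).2 ?_).symm
    have := Submodule.smul_mem W (algebraMap k A c) (Submodule.mem_sup_left
      (Submodule.subset_span (by simp : ((1 - e p, 0) : A × A) ∈ _)))
    simpa [mul_sub, Algebra.smul_def] using this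
  have hq : Submodule.mkQ W (0, c • e q) = Submodule.mkQ W (c • (0, 1)) := by
    refine ((Submodule.Quotient.eq W).2 ?_).symm
    have := Submodule.smul_mem W (algebraMap k A c) (Submodule.mem_sup_left
      (Submodule.subset_span (by simp : ((0, 1 - e q) : A × A) ∈ _)))
    simpa [mul_sub, Algebra.smul_def] using this
  have g1 : (f - c • 1) (Submodule.mkQ W (1, 0)) = Submodule.mkQ W (α, β) := by
    rw [LinearMap.sub_apply, LinearMap.smul_apply, Module.End.one_apply, hsmul, ← hp]
    refine (congrArg (· - Submodule.mkQ W (c • e p, 0)) h1).trans ?_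
    rw [← map_sub]
    simp
  have g2 : (f - c • 1) (Submodule.mkQ W (0, 1)) = Submodule.mkQ W (γ, δ) := by
    rw [LinearMap.sub_apply, LinearMap.smul_apply, Module.End.one_apply, hsmul, ← hq]
    refine (congrArg (· - Submodule.mkQ W (0, c • e q)) h2).trans ?_
    rw [← map_sub]
    simp
  have hmap : ∀ u v, (f - c • 1) (Submodule.mkQ W (u, v)) =
      Submodule.mkQ W (u * α + v * γ, u * β + v * δ) := by
    intro u v
    rw [hgen, map_add, map_smul, map_smul, g1, g2, ← map_smul, ← map_smul, ← map_add]
    rfl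
  have hN : ∀ u v, u ∈ N → v ∈ N → Submodule.mkQ W (u, v) = 0 := fun u v hu hv =>
    (Submodule.Quotient.mk_eq_zero W).2 (prod_le_twoVertexRelations ⟨hu, hv⟩)
  have k1 : (f - c • 1) ((f - c • 1) (Submodule.mkQ W (1, 0))) = 0 := by
    rw [g1, hmap]
    exact hN _ _
      (add_mem (D.mul_mem p p p (.inl rfl) (.inl rfl) (.inl rfl) _ hα hαr _ hα hαr)
        (D.mul_mem p q p (.inl rfl) (.inr rfl) (.inl rfl) _ hβ hβr _ hγ hγr))
      (add_mem (D.mul_mem p p q (.inl rfl) (.inl rfl) (.inr rfl) _ hα hαr _ hβ hβr)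
        (D.mul_mem p q q (.inl rfl) (.inr rfl) (.inr rfl) _ hβ hβr _ hδ hδr))
  have k2 : (f - c • 1) ((f - c • 1) (Submodule.mkQ W (0, 1))) = 0 := by
    rw [g2, hmap]
    exact hN _ _
      (add_mem (D.mul_mem q p p (.inr rfl) (.inl rfl) (.inl rfl) _ hγ hγr _ hα hαr)
        (D.mul_mem q q p (.inr rfl) (.inr rfl) (.inl rfl) _ hδ hδr _ hγ hγr))
      (add_mem (D.mul_mem q p q (.inr rfl) (.inl rfl) (.inr rfl) _ hγ hγr _ hβ hβr)
        (D.mul_mem q q q (.inr rfl) (.inr rfl) (.inr rfl) _ hδ hδr _ hδ hδr))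
  refine LinearMap.ext fun z => ?_
  obtain ⟨⟨u, v⟩, rfl⟩ := Submodule.mkQ_surjective W z
  rw [pow_two, Module.End.mul_apply, hgen, map_add, map_smul, map_smul, map_add, map_smul,
    map_smul, k1, k2, smul_zero, smul_zero, add_zero, LinearMap.zero_apply]

theorem TwoVertexData.false [Infinite k] {l : ℕ} (hl : 𝔯 ^ l ≤ N) : False := by
  have hfin : ∀ t, Module.Finite k ((A × A) ⧸ twoVertexRelations e p q N x b b' y t) := fun t =>
    S.admissible.finite_quotient_prod hl (prod_le_twoVertexRelations (k := k))
  refine S.mild.false_of_family (I := 𝔯 ^ l) (S.admissible.jacobson_pow_ne_bot S.infinite l)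
    (isRadicallyClosed_of_jacobson_pow_le le_rfl)
    (fun t : k => (A × A) ⧸ twoVertexRelations e p q N x b b' y t) ?_
    (fun t => isFiniteLength_of_finite k) (D.isIndecomposable S) ?_
  · rintro t z ⟨a, ha⟩
    obtain ⟨⟨u, v⟩, rfl⟩ := Submodule.mkQ_surjective _ z
    refine (Submodule.Quotient.mk_eq_zero _).2 (prod_le_twoVertexRelations ⟨?_, ?_⟩)
    · exact hl (mul_mem_jacobson_pow_right u ha)
    · exact hl (mul_mem_jacobson_pow_right v ha)
  · rintro t t' ⟨F⟩
    obtain ⟨c, α, β, γ, δ, hc, ⟨hα, hαr⟩, ⟨hβ, hβr⟩, -, -, h1, -⟩ :=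
      D.exists_of_hom S F.toLinearMap
    -- For c = 0 the element x times the first generator is sent into N, so its class would vanish
    -- already in the source. For c ≠ 0 the relation c t' = t c gives t = t'.
    rcases eq_or_ne c 0 with rfl | hc0
    · exfalso
      refine D.notMem_relations S t ((Submodule.Quotient.mk_eq_zero _).1
        ((map_eq_zero_iff F F.injective).1 ?_))
      have h2 : Submodule.mkQ (twoVertexRelations e p q N x b b' y t) (x, 0) =
          x • Submodule.mkQ _ (1, 0) := by
        rw [← map_smul]
        simp
      refine (congrArg F h2).trans ?_
      rw [map_smul]
      refine (congrArg (x • ·) h1).trans ?_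
      rw [← map_smul, zero_smul, zero_add]
      exact (Submodule.Quotient.mk_eq_zero _).2 (prod_le_twoVertexRelations
        ⟨D.mul_mem p p p (.inl rfl) (.inl rfl) (.inl rfl) _ D.mem_x D.jac_x _ hα hαr,
          D.mul_mem p p q (.inl rfl) (.inl rfl) (.inr rfl) _ D.mem_x D.jac_x _ hβ hβr⟩)
    · rw [mul_comm t] at hc
      exact (mul_left_cancel₀ hc0 hc).symm

end IsMildSystem

end TwoVertexFamily

/-! ### Cycles through two vertices and uniqueness of arrows -/

section Arrows

variable {k : Type u} {A : Type v} [Field k] [Ring A] [Algebra k A] {ι : Type w} {e : ι → A}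

local notation "𝔯" => Ring.jacobson A

namespace IsMildSystem

variable [Fintype ι] (S : IsMildSystem k e)

include S

theorem exists_notMem_jacobson_pow {a : A} (ha : a ≠ 0) : ∃ l : ℕ, a ∉ 𝔯 ^ l := by
  by_contra! h
  exact ha (S.admissible.eq_zero h)

variable {p q : ι} {g : ι → ι → A} (hg : ∀ i j, IsRadicalGenerator k e i j (g i j))

include hg

/-- The product is s g_ii for some s; a unit s would express g_ii through the cycle. -/
theorem exists_mul_eq_of_not_exists {i j : ι}
    (h : ¬ ∃ s ∈ corner k e i i, g i i = s * (g i j * g j i)) :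
    ∃ r ∈ corner k e i i, r ∈ 𝔯 ∧ g i j * g j i = r * g i i := by
  obtain ⟨s, hs, hsg⟩ := (hg i i).left _ (mul_mem_corner (hg i j).mem (hg j i).mem)
    (Ideal.mul_mem_left _ _ (hg j i).mem_jacobson)
  refine ⟨s, hs, ?_, hsg⟩
  by_contra hsr
  obtain ⟨v, hv, -, -, hvs⟩ := S.exists_inverse hs hsr
  exact h ⟨v, hv, by rw [hsg, ← mul_assoc, hvs, (hg i i).mem.1]⟩

/-- Otherwise R e_j ⊆ R^2; iterating, R e_j lies in every power of R and vanishes, although it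
contains g_jj. -/
theorem exists_notMem_jacobson_sq (j : ι) : ∃ i, g i j ∉ 𝔯 ^ 2 := by
  by_contra! hcon
  have h1 : ∀ r ∈ 𝔯, r * e j ∈ 𝔯 ^ 2 := by
    intro r hr
    have : r * e j = ∑ i, e i * r * e j := by
      rw [← Finset.sum_mul, ← Finset.sum_mul, S.complete.complete, one_mul]
    rw [this]
    refine sum_mem fun i _ => ?_
    obtain ⟨s, -, hs⟩ := (hg i j).left _ (S.mul_mul_mem_corner i j r)
      (Ideal.mul_mem_right _ _ (Ideal.mul_mem_left _ _ hr))
    rw [hs]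
    exact mul_mem_jacobson_pow_left _ (hcon i)
  have h2 : ∀ l, ∀ r ∈ 𝔯 ^ (l + 1), r * e j ∈ 𝔯 ^ (l + 2) := by
    intro l r hr
    rw [Submodule.pow_succ] at hr
    refine Submodule.smul_induction_on hr (fun s hs t ht => ?_) (fun x y hx hy => ?_)
    · rw [smul_eq_mul, mul_assoc]
      exact mul_mem_jacobson_pow_add hs (h1 t ht)
    · rw [add_mul]
      exact add_mem hx hy
  have h3 : ∀ r ∈ 𝔯, ∀ l, r * e j ∈ 𝔯 ^ (l + 1) := by
    intro r hr l
    induction l with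
    | zero => exact mem_jacobson_pow_one.2 (Ideal.mul_mem_right _ _ hr)
    | succ l ih =>
      have := h2 l _ ih
      rwa [mul_assoc, S.idem] at this
  refine (hg j j).ne_zero (S.admissible.eq_zero fun l => ?_)
  rw [← (hg j j).mem.2]
  exact Ideal.pow_le_pow_right (Nat.le_succ l) (h3 _ (hg j j).mem_jacobson l)

variable [Infinite k]

/-- Moved across g_pq, the element g_pp becomes a radical element at q, hence a multiple of g_qp
g_pq; moving the coefficient back and cancelling g_pq gives the cycle at p. So the failure assumed
in `exists_radical_eq_mul` occurs at both vertices at once. -/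
theorem exists_radical_eq_mul_of_exists
    (h : ∃ s ∈ corner k e q q, g q q = s * (g q p * g p q)) :
    ∃ s ∈ corner k e p p, g p p = s * (g p q * g q p) := by
  obtain ⟨s, hs, hsq⟩ := h
  obtain ⟨η, hη, hxη⟩ := (hg p q).exists_mul_eq_right (hg p p).mem
  have hηr := (hg p q).mem_jacobson_right S (hg p p).mem hη (hg p p).mem_jacobson hxη.symm
  obtain ⟨t, ht, rfl⟩ := (hg q q).left η hη hηr
  obtain ⟨r, hr, hrb⟩ := (hg p q).exists_mul_eq_left (mul_mem_corner ht hs)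
  refine ⟨r, hr, ?_⟩
  refine S.corner_mul_right_cancel (hg p q).mem (hg p q).ne_zero (hg p p).mem
    (mul_mem_corner hr (mul_mem_corner (hg p q).mem (hg q p).mem)) ?_
  rw [hxη, hsq, ← mul_assoc r, ← hrb]
  noncomm_ring

/-- The radical of a local corner is generated by the cycle through any other vertex. -/
theorem exists_radical_eq_mul (hpq : p ≠ q) :
    ∃ s ∈ corner k e p p, g p p = s * (g p q * g q p) := by
  by_contra hp
  have hq : ¬ ∃ s ∈ corner k e q q, g q q = s * (g q p * g p q) := fun h =>
    hp (S.exists_radical_eq_mul_of_exists hg h)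
  -- Every product g_ij g_jl is a radical multiple of g_il: trivially for i = j, by moving g_jj
  -- across g_ij for j = l, and by the negated claim at i for a genuine cycle i → j → i.
  have hmul : ∀ i j l, (i = p ∨ i = q) → (j = p ∨ j = q) → (l = p ∨ l = q) →
      ∃ r ∈ corner k e i i, r ∈ 𝔯 ∧ g i j * g j l = r * g i l := by
    intro i j l hi hj hl
    rcases eq_or_ne i j with rfl | hij
    · exact ⟨_, (hg i i).mem, (hg i i).mem_jacobson, rfl⟩
    rcases eq_or_ne j l with rfl | hjl
    · obtain ⟨r, hr, h⟩ := (hg i j).exists_mul_eq_left (hg j j).mem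
      exact ⟨r, hr, (hg i j).mem_jacobson_left S hr (hg j j).mem (hg j j).mem_jacobson h, h⟩
    have hil : i = l := by
      rcases hi with rfl | rfl <;> rcases hj with rfl | rfl <;> rcases hl with rfl | rfl <;>
        first | rfl | exact (hij rfl).elim | exact (hjl rfl).elim
    subst hil
    refine S.exists_mul_eq_of_not_exists hg ?_
    rcases hi with rfl | rfl <;> rcases hj with rfl | rfl <;>
      first | exact hp | exact hq | exact (hij rfl).elim
  -- N consists of the elements all of whose components at p and q, after any left multiplication,
  -- are radical multiples of the g_ij; it contains the radical square at the two vertices but no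
  -- g_ij with i, j among p, q.
  let N : Ideal A :=
    { carrier := {a | ∀ s : A, ∀ i j, (i = p ∨ i = q) → (j = p ∨ j = q) →
        ∃ r ∈ corner k e i i, r ∈ 𝔯 ∧ e i * s * a * e j = r * g i j}
      zero_mem' := fun s i j _ _ => ⟨0, zero_mem _, zero_mem _, by simp⟩
      add_mem' := fun {a b} ha hb s i j hi hj => by
        obtain ⟨r, hr, hrr, h⟩ := ha s i j hi hj
        obtain ⟨r', hr', hrr', h'⟩ := hb s i j hi hj
        exact ⟨r + r', add_mem hr hr', add_mem hrr hrr', by rw [mul_add, add_mul, h, h', add_mul]⟩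
      smul_mem' := fun c a ha s i j hi hj => by
        obtain ⟨r, hr, hrr, h⟩ := ha (s * c) i j hi hj
        exact ⟨r, hr, hrr, by rw [← h, smul_eq_mul]; noncomm_ring⟩ }
  have hNmul : ∀ l, ∀ n ∈ N, n * e l ∈ N := by
    intro l n hn s i j hi hj
    rcases eq_or_ne l j with rfl | hlj
    · obtain ⟨r, hr, hrr, h⟩ := hn s i l hi hj
      exact ⟨r, hr, hrr, by rw [← h, ← mul_assoc, mul_assoc _ (e l), S.idem]⟩
    · refine ⟨0, zero_mem _, zero_mem _, ?_⟩
      rw [← mul_assoc, mul_assoc _ (e l), S.complete.ortho hlj, mul_zero, zero_mul]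
  have hnot : ∀ i j, (i = p ∨ i = q) → (j = p ∨ j = q) → g i j ∉ N := by
    intro i j hi hj hN
    obtain ⟨r, hr, hrr, h⟩ := hN 1 i j hi hj
    rw [mul_one, (hg i j).mem.1, (hg i j).mem.2] at h
    exact S.notMem_of_mul_eq (hg i j).mem (hg i j).ne_zero hr h.symm hrr
  have D : TwoVertexData (k := k) e p q N (g p p) (g p q) (g q p) (g q q) :=
    { ne := hpq
      mul_left_mem := hNmul p
      mul_right_mem := hNmul q
      mul_mem := by
        intro i j l hi hj hl s hs hsr t ht htr a i' j' hi' hj'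
        rcases eq_or_ne l j' with rfl | hlj
        · have h1 : e i' * a * (s * t) * e l = (e i' * a * e i * s) * t := by
            rw [mul_assoc _ (s * t), mul_assoc s, ht.2, mul_assoc _ (e i) s, hs.1, mul_assoc,
              mul_assoc, mul_assoc]
          obtain ⟨u, hu, hug⟩ := (hg i' j).left _
            (mul_mem_corner (S.mul_mul_mem_corner i' i a) hs) (Ideal.mul_mem_left _ _ hsr)
          obtain ⟨v, hv, rfl⟩ := (hg j l).left t ht htr
          obtain ⟨w, hw, hwg⟩ := (hg i' j).exists_mul_eq_left hv
          obtain ⟨r, hr, hrr, hrg⟩ := hmul i' j l hi' hj hl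
          refine ⟨u * (w * r), mul_mem_corner hu (mul_mem_corner hw hr),
            Ideal.mul_mem_left _ _ (Ideal.mul_mem_left _ _ hrr), ?_⟩
          rw [h1, hug, mul_assoc u, ← mul_assoc _ v, hwg, mul_assoc w, hrg]
          noncomm_ring
        · refine ⟨0, zero_mem _, zero_mem _, ?_⟩
          rw [mul_assoc _ (s * t), mul_assoc s, ← ht.2, mul_assoc t, S.complete.ortho hlj]
          simp
      mem_x := (hg p p).mem
      mem_b := (hg p q).mem
      mem_b' := (hg q p).mem
      mem_y := (hg q q).mem
      jac_x := (hg p p).mem_jacobson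
      jac_y := (hg q q).mem_jacobson
      notMem_x := hnot p p (.inl rfl) (.inl rfl)
      notMem_b := hnot p q (.inl rfl) (.inr rfl)
      notMem_b' := hnot q p (.inr rfl) (.inl rfl)
      notMem_y := hnot q q (.inr rfl) (.inr rfl) }
  -- Beyond this power of R the coefficient of g_ij must be radical: a unit coefficient would put
  -- g_ij itself into that power. The sum bounds all the L ij at once.
  choose L hL using fun ij : ι × ι => S.exists_notMem_jacobson_pow (hg ij.1 ij.2).ne_zero
  refine D.false S (l := ∑ ij, L ij) ?_
  intro a ha s i j _ _
  have hgl : g i j ∉ 𝔯 ^ (∑ ij, L ij) := fun h => hL (i, j) (Ideal.pow_le_pow_right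
    (Finset.single_le_sum (f := L) (fun _ _ => Nat.zero_le _) (Finset.mem_univ (i, j))) h)
  have hl0 : ∑ ij, L ij ≠ 0 := by
    intro h0
    rw [h0] at hgl
    exact hgl (mem_jacobson_pow_zero _)
  have hmem : e i * s * a * e j ∈ 𝔯 ^ (∑ ij, L ij) :=
    mul_mem_jacobson_pow_right _ (mul_mem_jacobson_pow_left _ ha)
  have hcor : e i * s * a * e j ∈ corner k e i j := by
    rw [mul_assoc (e i) s]
    exact S.mul_mul_mem_corner _ _ _
  obtain ⟨r, hr, h⟩ := (hg i j).left _ hcor (mem_jacobson_of_mem_pow hl0 hmem)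
  refine ⟨r, hr, ?_, h⟩
  by_contra hrr
  obtain ⟨v, hv, -, -, hvr⟩ := S.exists_inverse hr hrr
  apply hgl
  have : g i j = v * (e i * s * a * e j) := by rw [h, ← mul_assoc, hvr, (hg i j).mem.1]
  rw [this]
  exact mul_mem_jacobson_pow_left _ hmem

/-- At most one arrow starts at each vertex. -/
theorem eq_of_notMem_jacobson_sq {j : ι} (hp : g p j ∉ 𝔯 ^ 2) (hq : g q j ∉ 𝔯 ^ 2) : p = q := by
  by_contra hpq
  obtain ⟨y, hy, hyg⟩ := (hg p j).left _ (mul_mem_corner (hg p q).mem (hg q j).mem)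
    (Ideal.mul_mem_left _ _ (hg q j).mem_jacobson)
  -- A unit y would make g_pj a multiple of the product g_pq g_qj, hence an element of R^2.
  have hyr : y ∈ 𝔯 := by
    by_contra hyr
    obtain ⟨v, hv, -, -, hvy⟩ := S.exists_inverse hy hyr
    apply hp
    have : g p j = v * (g p q * g q j) := by rw [hyg, ← mul_assoc, hvy, (hg p j).mem.1]
    rw [this]
    exact mul_mem_jacobson_pow_left _
      (mul_mem_jacobson_sq (hg p q).mem_jacobson (hg q j).mem_jacobson)
  obtain ⟨s, hs, hsp⟩ := S.exists_radical_eq_mul hg hpq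
  -- Now y is a multiple of g_pq g_qp. Moving the coefficient across g_pq and cancelling g_pq on the
  -- left gives g_qj = r g_qp g_pj, which lies in R^2.
  obtain ⟨t, ht, rfl⟩ := (hg p p).left y hy hyr
  obtain ⟨r, hr, hrb⟩ := (hg p q).exists_mul_eq_right (mul_mem_corner ht hs)
  apply hq
  have : g q j = r * (g q p * g p j) := by
    refine S.corner_mul_left_cancel (hg p q).mem (hg p q).ne_zero (hg q j).mem
      (mul_mem_corner hr (mul_mem_corner (hg q p).mem (hg p j).mem)) ?_
    rw [hyg, hsp, ← mul_assoc _ r, ← hrb]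
    noncomm_ring
  rw [this]
  exact mul_mem_jacobson_pow_left _
    (mul_mem_jacobson_sq (hg q p).mem_jacobson (hg p j).mem_jacobson)

end IsMildSystem

end Arrows

/-! ### Algebras in which exactly one arrow starts at each vertex -/

section ArrowSystem

variable {k : Type u} {A : Type v} [Field k] [Ring A] [Algebra k A] {ι : Type w}

local notation "𝔯" => Ring.jacobson A

/-- The vertex reached from `i` after a number of steps. -/
def forwardVertex (σ : ι → ι) (i : ι) : ℕ → ι
  | 0 => i
  | l + 1 => σ (forwardVertex σ i l)

theorem forwardVertex_eq_iterate (σ : ι → ι) (i : ι) (l : ℕ) : forwardVertex σ i l = σ^[l] i := by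
  induction l with
  | zero => rfl
  | succ l ih => rw [Function.iterate_succ_apply', ← ih, forwardVertex]

theorem forwardVertex_forwardVertex (σ : ι → ι) (i : ι) (l m : ℕ) :
    forwardVertex σ (forwardVertex σ i l) m = forwardVertex σ i (l + m) := by
  rw [forwardVertex_eq_iterate, forwardVertex_eq_iterate, forwardVertex_eq_iterate, add_comm,
    Function.iterate_add_apply]

/-- The product of the arrows along the path of length `l` starting at `i`. -/
def pathElement (e : ι → A) (σ : ι → ι) (α : ι → A) (i : ι) : ℕ → A
  | 0 => e i
  | l + 1 => α (forwardVertex σ i l) * pathElement e σ α i l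

/-- The homogeneous component of a family of coefficients. -/
def pathTerm [Fintype ι] (e : ι → A) (σ : ι → ι) (α : ι → A) (h : ι → ℕ → k) (m : ℕ) : A :=
  ∑ i, h i m • pathElement e σ α i m

variable (k) in
/-- Orthogonal idempotents `e` and elements `α` of the radical which represent the only arrows:
there is one arrow from each vertex `i` to `σ i`. -/
structure IsArrowSystem [Fintype ι] (e : ι → A) (σ : ι → ι) (α : ι → A) : Prop where
  admissible : IsAdmissibleAlgebra k A
  complete : CompleteOrthogonalIdempotents e
  vertex : ∀ i a, ∃ c : k, a * e i - c • e i ∈ 𝔯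
  arrow : ∀ i, ∀ a ∈ 𝔯, ∃ c : k, a * e i - c • α i ∈ 𝔯 ^ 2
  mem_corner : ∀ i, α i ∈ corner k e (σ i) i
  mem_jacobson : ∀ i, α i ∈ 𝔯

namespace IsArrowSystem

variable [Fintype ι] {e : ι → A} {σ : ι → ι} {α : ι → A} (S : IsArrowSystem k e σ α)

include S

theorem self_mem_corner (i : ι) : e i ∈ corner k e i i :=
  ⟨S.complete.idem i, S.complete.idem i⟩

theorem pathElement_mem_corner (i : ι) (l : ℕ) :
    pathElement e σ α i l ∈ corner k e (forwardVertex σ i l) i := by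
  induction l with
  | zero => exact S.self_mem_corner i
  | succ l ih => exact mul_mem_corner (S.mem_corner _) ih

theorem pathElement_mem_pow (i : ι) (l : ℕ) : pathElement e σ α i l ∈ 𝔯 ^ l := by
  induction l with
  | zero => exact mem_jacobson_pow_zero _
  | succ l ih =>
    rw [pathElement, add_comm l 1]
    exact mul_mem_jacobson_pow_add (mem_jacobson_pow_one.2 (S.mem_jacobson _)) ih

theorem pathElement_mul (i : ι) (l m : ℕ) :
    pathElement e σ α (forwardVertex σ i l) m * pathElement e σ α i l =
      pathElement e σ α i (l + m) := by
  induction m with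
  | zero => exact (S.pathElement_mem_corner i l).1
  | succ m ih =>
    rw [← add_assoc, pathElement, pathElement, mul_assoc, ih, forwardVertex_forwardVertex]

theorem pathElement_mul_of_ne {i j : ι} {l : ℕ} (m : ℕ) (h : j ≠ forwardVertex σ i l) :
    pathElement e σ α j m * pathElement e σ α i l = 0 := by
  rw [← (S.pathElement_mem_corner j m).2, ← (S.pathElement_mem_corner i l).1, mul_assoc,
    ← mul_assoc (e j), S.complete.ortho h, zero_mul, mul_zero]

/-- Modulo the next power of the radical there is only one path of given length and source. -/
theorem exists_sub_smul_pathElement_mem (i : ι) (l : ℕ) {a : A} (ha : a ∈ 𝔯 ^ l) :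
    ∃ c : k, a * e i - c • pathElement e σ α i l ∈ 𝔯 ^ (l + 1) := by
  induction l generalizing a with
  | zero =>
    obtain ⟨c, hc⟩ := S.vertex i a
    exact ⟨c, by rwa [zero_add, mem_jacobson_pow_one]⟩
  | succ l ih =>
    refine Submodule.smul_induction_on (jacobson_pow_succ_le l ha) (fun s hs t ht => ?_)
      (fun x y hx hy => ?_)
    · obtain ⟨c, hc⟩ := ih ht
      obtain ⟨d, hd⟩ := S.arrow (forwardVertex σ i l) s hs
      refine ⟨c * d, ?_⟩
      have h1 := mul_mem_jacobson_pow_add (mem_jacobson_pow_one.2 hs) hc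
      have h2 := Ideal.smul_mem_of_algebra _ c
        (mul_mem_jacobson_pow_add hd (S.pathElement_mem_pow i l))
      rw [add_comm] at h1
      rw [add_comm] at h2
      have := add_mem h1 h2
      convert this using 1
      rw [sub_mul, mul_assoc s (e _), (S.pathElement_mem_corner i l).1, pathElement, mul_sub,
        mul_smul_comm, smul_mul_assoc, smul_mul_assoc, smul_eq_mul, smul_sub, mul_smul]
      abel
    · obtain ⟨c, hc⟩ := hx
      obtain ⟨d, hd⟩ := hy
      refine ⟨c + d, ?_⟩
      convert add_mem hc hd using 1
      rw [add_mul, add_smul]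
      abel

/-- If i were never reached from j, multiplication by e_i would kill the leading path of a at every
level, pushing a into all powers of R. -/
theorem exists_forwardVertex_eq {i j : ι} (h : ∃ a ∈ corner k e i j, a ≠ 0) :
    ∃ l, forwardVertex σ j l = i := by
  by_contra! hcon
  obtain ⟨a, ha, ha0⟩ := h
  refine ha0 (S.admissible.eq_zero fun l => ?_)
  induction l with
  | zero => exact mem_jacobson_pow_zero _
  | succ l ih =>
    obtain ⟨c, hc⟩ := S.exists_sub_smul_pathElement_mem j l ih
    have h1 := mul_mem_jacobson_pow_left (e i) hc
    rwa [mul_sub, ha.2, ha.1, mul_smul_comm, ← (S.pathElement_mem_corner j l).1, ← mul_assoc,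
      S.complete.ortho (hcon l).symm, zero_mul, smul_zero, sub_zero] at h1

theorem reindex {κ : Type*} [Fintype κ] (τ : κ ≃ ι) {ρ : κ → κ} (h : ∀ a, τ (ρ a) = σ (τ a)) :
    IsArrowSystem k (e ∘ τ) ρ (α ∘ τ) where
  admissible := S.admissible
  complete := (CompleteOrthogonalIdempotents.equiv τ).2 S.complete
  vertex i a := S.vertex (τ i) a
  arrow i a ha := S.arrow (τ i) a ha
  mem_corner i := by
    have := S.mem_corner (τ i)
    rw [← h] at this
    exact this
  mem_jacobson i := S.mem_jacobson (τ i)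

theorem pathTerm_mem (h : ι → ℕ → k) (m : ℕ) : pathTerm e σ α h m ∈ 𝔯 ^ m :=
  sum_mem fun i _ => Ideal.smul_mem_of_algebra _ _ (S.pathElement_mem_pow i m)

theorem pathTerm_mul_idempotent (h : ι → ℕ → k) (m : ℕ) (i : ι) :
    pathTerm e σ α h m * e i = h i m • pathElement e σ α i m := by
  classical
  rw [pathTerm, Finset.sum_mul, Finset.sum_eq_single i]
  · rw [smul_mul_assoc, (S.pathElement_mem_corner i m).2]
  · intro j _ hj
    rw [smul_mul_assoc, ← (S.pathElement_mem_corner j m).2, mul_assoc, S.complete.ortho hj,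
      mul_zero, smul_zero]
  · simp

theorem pathTerm_mul (h h' : ι → ℕ → k) (u v : ℕ) :
    pathTerm e σ α h v * pathTerm e σ α h' u =
      ∑ i, (h (forwardVertex σ i u) v * h' i u) • pathElement e σ α i (u + v) := by
  rw [pathTerm, pathTerm, Finset.mul_sum]
  refine Finset.sum_congr rfl fun i _ => ?_
  rw [Finset.sum_mul, Finset.sum_eq_single (forwardVertex σ i u)]
  · rw [smul_mul_assoc, mul_smul_comm, smul_smul, S.pathElement_mul]
  · intro j _ hj
    rw [smul_mul_assoc, mul_smul_comm, S.pathElement_mul_of_ne v hj, smul_zero, smul_zero]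
  · simp

theorem exists_pathSeries (h : ι → ℕ → k) :
    ∃ a, ∀ l, a - ∑ m ∈ Finset.range l, pathTerm e σ α h m ∈ 𝔯 ^ l :=
  S.admissible.exists_sum _ (S.pathTerm_mem h)

/-- Successive approximation: the remainder in R^l is corrected by the unique path of length l from
each source. -/
theorem exists_coefficients (a : A) :
    ∃ h : ι → ℕ → k, ∀ l, a - ∑ m ∈ Finset.range l, pathTerm e σ α h m ∈ 𝔯 ^ l := by
  have hstep : ∀ l (b : {b : A // b ∈ 𝔯 ^ l}), ∃ c : ι → k,
      b.1 - ∑ i, c i • pathElement e σ α i l ∈ 𝔯 ^ (l + 1) := by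
    intro l b
    choose c hc using fun i => S.exists_sub_smul_pathElement_mem i l b.2
    refine ⟨c, ?_⟩
    have : b.1 = ∑ i, b.1 * e i := by rw [← Finset.mul_sum, S.complete.complete, mul_one]
    rw [this, ← Finset.sum_sub_distrib]
    exact sum_mem fun i _ => hc i
  choose c hc using hstep
  let b : ∀ l, {b : A // b ∈ 𝔯 ^ l} := fun l =>
    Nat.rec ⟨a, mem_jacobson_pow_zero _⟩ (fun l b => ⟨_, hc l b⟩) l
  refine ⟨fun i l => c l (b l) i, fun l => ?_⟩
  have : ∀ l, a - ∑ m ∈ Finset.range l,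
      pathTerm e σ α (fun i l => c l (b l) i) m = (b l).1 := by
    intro l
    induction l with
    | zero => simp [b]
    | succ l ih =>
      rw [Finset.sum_range_succ, ← sub_sub, ih]
      rfl
  rw [this]
  exact (b l).2

/-- The product of the truncations differs from the truncated Cauchy product only by terms with u +
v ≥ l. -/
theorem sum_mul_sum_sub_mem (h h' : ι → ℕ → k) (l : ℕ) :
    (∑ m ∈ Finset.range l, pathTerm e σ α h m) *
        (∑ m ∈ Finset.range l, pathTerm e σ α h' m) -
      ∑ m ∈ Finset.range l, pathTerm e σ α
        (fun i m => ∑ uv ∈ Finset.HasAntidiagonal.antidiagonal m,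
          h (forwardVertex σ i uv.1) uv.2 * h' i uv.1) m ∈ 𝔯 ^ l := by
  have h1 : ∀ m, pathTerm e σ α (fun i m => ∑ uv ∈ Finset.HasAntidiagonal.antidiagonal m,
      h (forwardVertex σ i uv.1) uv.2 * h' i uv.1) m =
      ∑ u ∈ Finset.range (m + 1), pathTerm e σ α h (m - u) * pathTerm e σ α h' u := by
    intro m
    rw [← Finset.Nat.sum_antidiagonal_eq_sum_range_succ
      (fun u v => pathTerm e σ α h v * pathTerm e σ α h' u), pathTerm]
    simp only [S.pathTerm_mul, Finset.sum_smul]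
    rw [Finset.sum_comm]
    refine Finset.sum_congr rfl fun uv huv => ?_
    rw [Finset.HasAntidiagonal.mem_antidiagonal.1 huv]
  simp only [h1]
  rw [Finset.sum_range_diag_flip l
    (fun u v => pathTerm e σ α h v * pathTerm e σ α h' u), Finset.mul_sum,
    ← Finset.sum_sub_distrib]
  refine sum_mem fun u hu => ?_
  rw [Finset.sum_mul, ← Finset.sum_range_add_sum_Ico _ (Nat.sub_le l u), add_sub_cancel_left]
  refine sum_mem fun v hv => ?_
  have := mul_mem_jacobson_pow_add (S.pathTerm_mem h v) (S.pathTerm_mem h' u)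
  refine Ideal.pow_le_pow_right ?_ this
  have := (Finset.mem_Ico.1 hv).1
  omega

theorem eq_zero_of_pathSeries (hne : ∀ i l, ∃ r ∈ 𝔯 ^ l, r * e i ≠ 0) {h : ι → ℕ → k}
    (hh : ∀ l, ∑ m ∈ Finset.range l, pathTerm e σ α h m ∈ 𝔯 ^ l) : h = 0 := by
  -- If the path of length l from i fell into R^(l+1), all its prolongations would drop a level too,
  -- and R^l e_i would lie in every power of R.
  have hnot : ∀ i l, pathElement e σ α i l ∉ 𝔯 ^ (l + 1) := by
    intro i l hmem
    have h1 : ∀ r ∈ 𝔯 ^ l, r * e i ∈ 𝔯 ^ (l + 1) := by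
      intro r hr
      obtain ⟨c, hc⟩ := S.exists_sub_smul_pathElement_mem i l hr
      simpa using add_mem hc (Ideal.smul_mem_of_algebra _ c hmem)
    have h2 : ∀ m, pathElement e σ α i (l + m) ∈ 𝔯 ^ (l + m + 1) := by
      intro m
      rw [← S.pathElement_mul i l m, add_right_comm, add_comm]
      exact mul_mem_jacobson_pow_add (S.pathElement_mem_pow _ m) hmem
    obtain ⟨r, hr, hr0⟩ := hne i l
    refine hr0 (S.admissible.eq_zero fun m => ?_)
    have h3 : ∀ m, r * e i ∈ 𝔯 ^ (l + m) := by
      intro m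
      induction m with
      | zero => exact mul_mem_jacobson_pow_right _ hr
      | succ m ih =>
        obtain ⟨c, hc⟩ := S.exists_sub_smul_pathElement_mem i _ ih
        rw [mul_assoc, S.complete.idem] at hc
        rw [← add_assoc]
        simpa using add_mem hc (Ideal.smul_mem_of_algebra _ c (h2 m))
    exact Ideal.pow_le_pow_right (Nat.le_add_left _ _) (h3 m)
  funext i m
  induction m using Nat.strong_induction_on with
  | _ m ih =>
    have h1 := mul_mem_jacobson_pow_right (e i) (hh (m + 1))
    rw [Finset.sum_mul, Finset.sum_range_succ, Finset.sum_eq_zero, zero_add,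
      S.pathTerm_mul_idempotent] at h1
    · by_contra h0
      refine hnot i m ?_
      have := Ideal.smul_mem_of_algebra _ (h i m)⁻¹ h1
      rwa [smul_smul, inv_mul_cancel₀ h0, one_smul] at this
    · intro j hj
      rw [S.pathTerm_mul_idempotent, ih j (Finset.mem_range.1 hj)]
      exact zero_smul _ _

end IsArrowSystem

end ArrowSystem

/-! ### The complete path algebra of a cyclic quiver -/

namespace CyclicQuiver

variable {k : Type u} {n : ℕ}

instance [NeZero n] : Fintype (CyclicQuiver n) :=
  inferInstanceAs (Fintype (ZMod n))

/-- The target of the arrow starting at a vertex. -/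
def next (i : CyclicQuiver n) : CyclicQuiver n :=
  (show ZMod n from i) + 1

/-- The arrow starting at `i`. -/
def arrow (i : CyclicQuiver n) : i ⟶ next i :=
  ⟨rfl⟩

/-- The path of length `l` starting at `i`. -/
def path (i : CyclicQuiver n) : ∀ l, Quiver.Path i (forwardVertex next i l)
  | 0 => .nil
  | l + 1 => (path i l).cons (arrow _)

theorem length_path (i : CyclicQuiver n) (l : ℕ) : (path i l).length = l := by
  induction l with
  | zero => rfl
  | succ l ih => exact congrArg (· + 1) ih

/-- A path of the cyclic quiver is determined by its source and length. The dependent F absorbs the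
change of endpoint without transport. -/
theorem eq_path {T : Sort*} {i j : CyclicQuiver n} (p : Quiver.Path i j)
    (F : ∀ j : CyclicQuiver n, Quiver.Path i j → T) :
    F j p = F (forwardVertex next i p.length) (path i p.length) := by
  induction p generalizing F with
  | nil => rfl
  | @cons l j p e ih =>
    obtain ⟨h⟩ := e
    have h : j = next l := h
    subst h
    exact ih fun m q => F (next m) (q.cons (arrow m))

theorem forwardVertex_length {i j : CyclicQuiver n} (p : Quiver.Path i j) :
    forwardVertex next i p.length = j :=
  (eq_path p fun j _ => j).symm

/-- The coefficients of a formal series, indexed by the sources and the lengths of the paths. -/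
def coefficient (c : CompletePathAlgebra k (CyclicQuiver n)) (i : CyclicQuiver n) (l : ℕ) : k :=
  c i (forwardVertex next i l) (path i l)

theorem apply_eq_coefficient (c : CompletePathAlgebra k (CyclicQuiver n)) {i j : CyclicQuiver n}
    (p : Quiver.Path i j) : c i j p = coefficient c i p.length :=
  eq_path p (c i)

theorem coefficient_injective :
    Function.Injective (coefficient : CompletePathAlgebra k (CyclicQuiver n) → _) := by
  intro c d h
  ext i j p
  exact (apply_eq_coefficient c p).trans (h ▸ (apply_eq_coefficient d p).symm)

theorem coefficient_surjective :
    Function.Surjective (coefficient : CompletePathAlgebra k (CyclicQuiver n) → _) := by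
  intro h
  refine ⟨fun i j p => h i p.length, ?_⟩
  funext i l
  exact congrArg (h i) (length_path i l)

variable [Field k]

theorem coefficient_one (i : CyclicQuiver n)
    (l : ℕ) :
    coefficient (1 : CompletePathAlgebra k (CyclicQuiver n)) i l = if l = 0 then 1 else 0 := by
  rw [coefficient, CompletePathAlgebra.one_apply, length_path]

/-- The left factor is an arbitrary f because the induction strips the last arrow of p, which
replaces φ by its shift by one. -/
theorem conv_eq_sum (b : CompletePathAlgebra k (CyclicQuiver n)) {i j : CyclicQuiver n}
    (p : Quiver.Path i j) (f : ∀ m : CyclicQuiver n, Quiver.Path m j → k) (φ : CyclicQuiver n → ℕ → k)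
    (hf : ∀ m (q : Quiver.Path m j), f m q = φ m q.length) :
    CompletePathAlgebra.conv f b i p = ∑ uv ∈ Finset.HasAntidiagonal.antidiagonal p.length,
      φ (forwardVertex next i uv.1) uv.2 * coefficient b i uv.1 := by
  induction p generalizing φ with
  | nil =>
    have hb := apply_eq_coefficient b (.nil : Quiver.Path i i)
    rw [CompletePathAlgebra.conv_nil, hf, hb]
    simp [forwardVertex]
  | @cons l j p e ih =>
    have hb := apply_eq_coefficient b (p.cons e)
    rw [CompletePathAlgebra.conv_cons, ih (fun m u => f m (u.cons e)) (fun m t => φ m (t + 1))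
      (fun m q => hf m (q.cons e)), hf, hb, Quiver.Path.length_cons,
      Finset.Nat.sum_antidiagonal_succ', ← Quiver.Path.length_cons i l j p e, forwardVertex_length]
    rfl

theorem coefficient_mul (a b : CompletePathAlgebra k (CyclicQuiver n)) (i : CyclicQuiver n)
    (l : ℕ) :
    coefficient (a * b) i l = ∑ uv ∈ Finset.HasAntidiagonal.antidiagonal l,
      coefficient a (forwardVertex next i uv.1) uv.2 * coefficient b i uv.1 := by
  rw [coefficient, CompletePathAlgebra.mul_apply_eq_conv,
    conv_eq_sum b _ _ (coefficient a) (fun m q => apply_eq_coefficient a q), length_path]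

end CyclicQuiver

/-! ### The isomorphism with the complete path algebra -/

section Main

variable {k : Type u} {A : Type v} [Field k] [Ring A] [Algebra k A]

local notation "𝔯" => Ring.jacobson A

open CyclicQuiver in
-- A series is sent to its limit in A. Uniqueness of limits turns the congruences for truncations
-- into the algebra laws; expansions in paths exist, and they are unique because no R^l e_i
-- vanishes.
theorem IsArrowSystem.nonempty_algEquiv {n : ℕ} [NeZero n] {e α : CyclicQuiver n → A}
    (S : IsArrowSystem k e next α) (hne : ∀ i l, ∃ r ∈ 𝔯 ^ l, r * e i ≠ 0) :
    Nonempty (A ≃ₐ[k] CompletePathAlgebra k (CyclicQuiver n)) := by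
  choose Φ hΦ using fun c : CompletePathAlgebra k (CyclicQuiver n) =>
    S.exists_pathSeries (coefficient c)
  have huniq : ∀ c a, (∀ l, a - ∑ m ∈ Finset.range l,
      pathTerm e next α (coefficient c) m ∈ 𝔯 ^ l) → Φ c = a := by
    intro c a ha
    refine S.admissible.eq_of_sub_mem fun l => ?_
    simpa using sub_mem (hΦ c l) (ha l)
  have hadd : ∀ c d, Φ (c + d) = Φ c + Φ d := by
    intro c d
    refine huniq _ _ fun l => ?_
    have : ∀ m, pathTerm e next α (coefficient (c + d)) m =
        pathTerm e next α (coefficient c) m + pathTerm e next α (coefficient d) m := by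
      intro m
      simp only [pathTerm, ← Finset.sum_add_distrib, ← add_smul]
      rfl
    simp only [this, Finset.sum_add_distrib]
    convert add_mem (hΦ c l) (hΦ d l) using 1
    abel
  have hsmul : ∀ (t : k) c, Φ (t • c) = t • Φ c := by
    intro t c
    refine huniq _ _ fun l => ?_
    have : ∀ m, pathTerm e next α (coefficient (t • c)) m =
        t • pathTerm e next α (coefficient c) m := by
      intro m
      simp only [pathTerm, Finset.smul_sum, smul_smul]
      rfl
    simp only [this, ← Finset.smul_sum, ← smul_sub]
    exact Ideal.smul_mem_of_algebra _ _ (hΦ c l)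
  have hone : Φ 1 = 1 := by
    refine huniq _ _ fun l => ?_
    rcases l with _ | l
    · exact mem_jacobson_pow_zero _
    have h0 : pathTerm e next α (coefficient (1 : CompletePathAlgebra k (CyclicQuiver n))) 0 =
        1 := by
      rw [← S.complete.complete, pathTerm]
      refine Finset.sum_congr rfl fun i _ => ?_
      rw [coefficient_one, if_pos rfl, one_smul]
      rfl
    have hsucc : ∀ m, pathTerm e next α
        (coefficient (1 : CompletePathAlgebra k (CyclicQuiver n))) (m + 1) = 0 := by
      intro m
      refine Finset.sum_eq_zero fun i _ => ?_
      rw [coefficient_one, if_neg (Nat.succ_ne_zero m), zero_smul]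
    rw [Finset.sum_range_succ', h0]
    simp [hsucc]
  have hmul : ∀ c d, Φ (c * d) = Φ c * Φ d := by
    intro c d
    refine huniq _ _ fun l => ?_
    have h1 := S.sum_mul_sum_sub_mem (coefficient c) (coefficient d) l
    have hcd : (fun i m => ∑ uv ∈ Finset.HasAntidiagonal.antidiagonal m,
        coefficient c (forwardVertex next i uv.1) uv.2 * coefficient d i uv.1) =
        coefficient (c * d) := by
      funext i m
      exact (coefficient_mul c d i m).symm
    rw [hcd] at h1
    have h2 := mul_mem_jacobson_pow_right (Φ d) (hΦ c l)
    have h3 := mul_mem_jacobson_pow_left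
      (∑ m ∈ Finset.range l, pathTerm e next α (coefficient c) m) (hΦ d l)
    convert add_mem (add_mem h2 h3) h1 using 1
    noncomm_ring
  let F : CompletePathAlgebra k (CyclicQuiver n) →ₐ[k] A :=
    AlgHom.ofLinearMap { toFun := Φ, map_add' := hadd, map_smul' := hsmul } hone hmul
  refine ⟨(AlgEquiv.ofBijective F ⟨?_, fun a => ?_⟩).symm⟩
  · rw [injective_iff_map_eq_zero]
    intro c hc
    have hc : Φ c = 0 := hc
    refine coefficient_injective ((S.eq_zero_of_pathSeries hne fun l => ?_).trans rfl)
    have := hΦ c l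
    rw [hc, zero_sub] at this
    simpa using neg_mem this
  · obtain ⟨h, hh⟩ := S.exists_coefficients a
    obtain ⟨c, rfl⟩ := coefficient_surjective h
    exact ⟨c, huniq c a hh⟩

/-- For fixed j, all g_ij but one lie in R^2, and σ j is the exceptional i. Modulo R^2 the
coefficient of the remaining generator counts only through its scalar part. -/
theorem IsMildSystem.exists_isArrowSystem {ι : Type w} [Fintype ι] [Infinite k] {e : ι → A}
    (S : IsMildSystem k e) : ∃ (σ : ι → ι) (α : ι → A), IsArrowSystem k e σ α := by
  choose g hg using S.exists_isRadicalGenerator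
  choose σ hσ using S.exists_notMem_jacobson_sq hg
  have hsum : ∀ a j, a * e j = ∑ i, e i * a * e j := fun a j => by
    rw [← Finset.sum_mul, ← Finset.sum_mul, S.complete.complete, one_mul]
  classical
  refine ⟨σ, fun i => g (σ i) i, S.admissible, S.complete, fun j a => ?_, fun j a ha => ?_,
    fun i => (hg _ _).mem, fun i => (hg _ _).mem_jacobson⟩
  · obtain ⟨c, hc⟩ := S.diagonal j a
    refine ⟨c, ?_⟩
    rw [hsum, ← Finset.add_sum_erase _ _ (Finset.mem_univ j), add_sub_right_comm]
    exact add_mem hc (sum_mem fun i hi => S.off_diagonal (Finset.ne_of_mem_erase hi) a)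
  · have hr : ∀ i, ∃ s ∈ corner k e i i, e i * a * e j = s * g i j := fun i =>
      (hg i j).left _ (S.mul_mul_mem_corner i j a)
        (Ideal.mul_mem_right _ _ (Ideal.mul_mem_left _ _ ha))
    obtain ⟨s, hs, hsg⟩ := hr (σ j)
    obtain ⟨c, r, hrc, hrr, rfl⟩ := S.exists_eq_smul_add hs
    refine ⟨c, ?_⟩
    rw [hsum, ← Finset.add_sum_erase _ _ (Finset.mem_univ (σ j)), add_sub_right_comm, hsg]
    refine add_mem ?_ (sum_mem fun i hi => ?_)
    · rw [add_mul, smul_mul_assoc, (hg _ _).mem.1, add_sub_cancel_left]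
      exact mul_mem_jacobson_sq hrr (hg _ _).mem_jacobson
    · obtain ⟨t, -, ht⟩ := hr i
      rw [ht]
      refine mul_mem_jacobson_pow_left _ ?_
      by_contra hij
      exact Finset.ne_of_mem_erase hi (S.eq_of_notMem_jacobson_sq hg hij (hσ j))

theorem IsMildSystem.exists_mul_ne_zero {ι : Type w} [Fintype ι] {e : ι → A}
    (S : IsMildSystem k e) (i : ι) (l : ℕ) : ∃ r ∈ 𝔯 ^ l, r * e i ≠ 0 := by
  obtain ⟨r, hr, hr0⟩ := Submodule.exists_mem_ne_zero_of_ne_bot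
    (S.admissible.jacobson_pow_ne_bot S.infinite l)
  obtain ⟨c, hc⟩ := exists_mul_mul_ne_zero S.admissible S.infinite S.mild S.toIsPrimitiveSystem
    hr0 (S.ne_zero i)
  exact ⟨r * c, mul_mem_jacobson_pow_right c hr, hc⟩

/-- A self-map of a nonempty type with only one orbit is a rotation of a cycle. -/
theorem exists_equiv_zmod {ι : Type w} [Finite ι] [Nonempty ι] {σ : ι → ι}
    (h : ∀ i j, ∃ l, forwardVertex σ j l = i) :
    ∃ (n : ℕ) (_ : NeZero n) (τ : ZMod n ≃ ι), ∀ a, τ (a + 1) = σ (τ a) := by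
  obtain ⟨j⟩ := ‹Nonempty ι›
  simp only [forwardVertex_eq_iterate] at h
  -- The vertex j is reachable from σ j, hence periodic, and its orbit is everything.
  have hper : j ∈ Function.periodicPts σ := by
    obtain ⟨l, hl⟩ := h j (σ j)
    exact ⟨l + 1, Nat.succ_pos l, by rwa [Function.IsPeriodicPt, Function.IsFixedPt,
      Function.iterate_succ_apply]⟩
  set n := Function.minimalPeriod σ j with hn
  have hpos : 0 < n := Function.minimalPeriod_pos_of_mem_periodicPts hper
  have : NeZero n := ⟨hpos.ne'⟩
  refine ⟨n, this, Equiv.ofBijective (fun a => σ^[a.val] j) ⟨fun a b hab => ?_, fun i => ?_⟩,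
    fun a => ?_⟩
  · exact ZMod.val_injective n ((Function.iterate_eq_iterate_iff_of_lt_minimalPeriod
      (ZMod.val_lt a) (ZMod.val_lt b)).1 hab)
  · obtain ⟨l, rfl⟩ := h i j
    refine ⟨(l : ZMod n), ?_⟩
    dsimp only
    rw [ZMod.val_natCast, Function.iterate_mod_minimalPeriod_eq]
  · change σ^[(a + 1).val] j = σ (σ^[a.val] j)
    rw [← Function.iterate_succ_apply' σ, ZMod.val_add, ZMod.val_one_eq_one_mod, Nat.add_mod_mod,
      Function.iterate_mod_minimalPeriod_eq]

end Main

theorem mainTheorem4 {k : Type u} [Field k] [IsAlgClosed k] {A : Type v} [Ring A] [Algebra k A]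
    (hadmissible : IsAdmissibleAlgebra k A) (hbasic : IsBasicAlgebra k A)
    (hinfinite : ¬ Module.Finite k A) (hmild : IsMildAlgebra A) :
    ∃ n : ℕ, 1 ≤ n ∧ Nonempty (A ≃ₐ[k] CompletePathAlgebra k (CyclicQuiver n)) := by
  obtain ⟨m, e, he⟩ := exists_isPrimitiveSystem hadmissible hbasic
  have S : IsMildSystem k e := ⟨he, hadmissible, hinfinite, hmild⟩
  have : Infinite k := IsAlgClosed.instInfinite
  obtain ⟨σ, α, T⟩ := S.exists_isArrowSystem
  -- Without vertices the unit, being the sum of the e_i, would be zero.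
  have : Nonempty (Fin m) := by
    by_contra hempty
    rw [not_nonempty_iff] at hempty
    have h1 : (1 : A) = 0 := by rw [← he.complete.complete, Finset.univ_eq_empty, Finset.sum_empty]
    have : Subsingleton A := subsingleton_of_zero_eq_one h1.symm
    exact hinfinite inferInstance
  -- Primeness makes all Peirce components nonzero, so every vertex is reachable from every other.
  obtain ⟨n, hn, τ, hτ⟩ := exists_equiv_zmod (σ := σ)
    fun i j => T.exists_forwardVertex_eq (S.exists_corner_ne_zero i j)
  exact ⟨n, NeZero.one_le, (T.reindex (ρ := CyclicQuiver.next) τ hτ).nonempty_algEquiv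
    fun i l => S.exists_mul_ne_zero (τ i) l⟩
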